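/- Let $\ell\ge 1$ and let $\mathcal A$ be a finite essential arrangement of affine hyperplanes in $\mathbb R^\ell=\mathbb P^\ell_{\mathbb R}\smallsetminus\overline H_\infty$ (essential: some intersection of hyperplanes of $\mathcal A$ is a point). Let $F^0\subset F^1\subset\dots\subset F^\ell=\mathbb R^\ell$ be a flag of affine subspaces with $\dim F^k=k$ that is generic, i.e. $\dim(X\cap\overline{F^k})=\dim X+k-\ell$ (empty if this is negative) for every intersection $X$ of members of $\overline{\mathcal A}=\{\overline H\mid H\in\mathcal A\}\cup\{\overline H_\infty\}$, and near to $\overline H_\infty$, i.e. for $1\le k\le\ell$ the hyperplane $F^{k-1}$ of $F^k$ does not separate the $0$-dimensional edges of $\mathcal A\cap F^k$. Put $F=F^{\ell-1}$ and $F^{-1}=\emptyset$, and let $\mathrm{bch}^{\ell-1}(\mathcal A)$ be the set of chambers $C$ (connected components of $\mathbb R^\ell\smallsetminus\bigcup_{H\in\mathcal A}H$) such that $C\cap F\ne\emptyset$, $C\cap F^{\ell-2}=\emptyset$ and $C\cap F$ is bounded. For an unbounded chamber $C$ with closure $\overline C$ in $\mathbb P^\ell_{\mathbb R}$, let $X(C)$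 be the projective subspace spanned by $\overline C\cap\overline H_\infty$, and let $C^\vee$ be the opposite chamber: the one entered from $C$ by crossing $\overline H_\infty$ along a line through a point of $C$ and a point of the relative interior of $\overline C\cap\overline H_\infty$. For $C\in\mathrm{bch}^{\ell-1}(\mathcal A)$ and a chamber $D$, take a closed ball $B\subset F$ containing all $0$-dimensional edges of $\mathcal A\cap F$ in its interior and a continuous vector field $U$ on $F$ directed to $D$: $U$ has no zeros on $\partial\overline C\cap B$, points strictly into $B$ on $\partial B\cap\overline C$, and at each $x\in H\cap F$, $H\in\mathcal A$, points strictly to the side of $H$ containing $D$. When $\ell\ge2$, define $\deg(C,D)\in\mathbb Z$ as the degree of the Gauss map $U/|U|:\partial(\overline C\cap B)\to S^{\ell-2}$, where the source and target carry the orientations induced by one orientation of $F$. Let $\mathrm{bch}^{\ell-1}(\mathcal A)=\{C_1,\dots,C_b\}$ be ordered, without repetition, so that $\dim X(C_1)\ge\dim X(C_2)\ge\dots\ge\dim X(C_b)$. Then $\deg(C_i,C_j^\vee)=0$ whenever $i>j$; that is, the matrix $(\deg(C_i,C_j^\vee))_{i,j=1}^b$ is upper triangular. (For $\ell=1$ one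 has $b=1$ and nothing is claimed.) -/

import Mathlib

open Set Filter Topology
open scoped LinearAlgebra.Projectivization

noncomputable section

namespace RealArrangement

/-! ### Arrangements, chambers, vertices -/

/-- The ambient real affine space of dimension `l`. -/
abbrev Space (l : ℕ) : Type := EuclideanSpace ℝ (Fin l)

/-- Affine hyperplanes: nonempty affine subspaces of codimension one. -/
def IsHyperplane {l : ℕ} (H : AffineSubspace ℝ (Space l)) : Prop :=
  (H : Set (Space l)).Nonempty ∧ Module.finrank ℝ H.direction + 1 = l

/-- The complement of the union of the hyperplanes. -/
def complement {l : ℕ} (A : Set (AffineSubspace ℝ (Space l))) : Set (Space l) :=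
  {x | ∀ H ∈ A, x ∉ H}

/-- The chambers: connected components of the complement. -/
def chambers {l : ℕ} (A : Set (AffineSubspace ℝ (Space l))) : Set (Set (Space l)) :=
  {C | ∃ x ∈ complement A, C = connectedComponentIn (complement A) x}

/-- The `0`-dimensional edges of the arrangement that `A` induces on the subspace `F`
(for `F = ⊤` those of `A` itself). -/
def vertices {l : ℕ} (A : Set (AffineSubspace ℝ (Space l))) (F : AffineSubspace ℝ (Space l)) :
    Set (Space l) :=
  {x | ∃ S ⊆ A, (⋂ H ∈ S, (H : Set (Space l))) ∩ (F : Set (Space l)) = {x}}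

/-- An arrangement is essential if it has a `0`-dimensional edge. -/
def IsEssential {l : ℕ} (A : Set (AffineSubspace ℝ (Space l))) : Prop :=
  (vertices A ⊤).Nonempty

/-! ### The projective closure

The projective space of dimension `l` is `ℙ ℝ (Space l × ℝ)`, with the quotient topology; the
affine space is embedded by `x ↦ [x : 1]`, and the hyperplane at infinity consists of the
points `[v : 0]`. Projective subspaces correspond to linear subspaces of `Space l × ℝ`, whose
dimension is one larger. -/

/-- The quotient topology on a real projective space. -/
instance projTopology (W : Type*) [AddCommGroup W] [Module ℝ W] [TopologicalSpace W] :
    TopologicalSpace (ℙ ℝ W) :=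
  TopologicalSpace.coinduced
    (fun w : {w : W // w ≠ 0} => Projectivization.mk ℝ w.1 w.2) inferInstance

/-- The linear subspace `{(v, 0)}` of `Space l × ℝ`, that is, the hyperplane at infinity. -/
def infinity (l : ℕ) : Submodule ℝ (Space l × ℝ) :=
  LinearMap.ker (LinearMap.snd ℝ (Space l) ℝ)

/-- The linear subspace of `Space l × ℝ` representing the projective closure of an affine
subspace. -/
def projClosure {l : ℕ} (F : AffineSubspace ℝ (Space l)) : Submodule ℝ (Space l × ℝ) :=
  Submodule.span ℝ ((fun x : Space l => (x, (1 : ℝ))) '' (F : Set (Space l)))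

/-- The edges of the projective closure of `A`: all intersections of projective closures of
hyperplanes of `A` and the hyperplane at infinity (the zero subspace stands for the empty
intersection in projective space). -/
def projEdges {l : ℕ} (A : Set (AffineSubspace ℝ (Space l))) :
    Set (Submodule ℝ (Space l × ℝ)) :=
  {X | ∃ S ⊆ insert (infinity l) (projClosure '' A), X = sInf S}

/-- The inclusion of the affine space in the projective space. -/
def toProj {l : ℕ} (x : Space l) : ℙ ℝ (Space l × ℝ) :=
  Projectivization.mk ℝ (x, (1 : ℝ)) (fun h => one_ne_zero (congrArg Prod.snd h))

/-- The intersection of the closure of `C` in projective space with the hyperplane at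
infinity. -/
def atInfinity {l : ℕ} (C : Set (Space l)) : Set (ℙ ℝ (Space l × ℝ)) :=
  {p | p ∈ closure (toProj '' C) ∧ p.submodule ≤ infinity l}

/-- `X(C)`: the projective subspace generated by the points at infinity of `C`. -/
def spanAtInfinity {l : ℕ} (C : Set (Space l)) : Projectivization.Subspace ℝ (Space l × ℝ) :=
  Projectivization.Subspace.span (atInfinity C)

/-- The projective dimension of `X(C)`. -/
def dimAtInfinity {l : ℕ} (C : Set (Space l)) : ℤ :=
  (Module.finrank ℝ (Projectivization.Subspace.submodule (spanAtInfinity C)) : ℤ) - 1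

/-- The relative interior of the set of points at infinity of `C`, that is, its interior as a
subset of `X(C)`. -/
def relIntAtInfinity {l : ℕ} (C : Set (Space l)) : Set (ℙ ℝ (Space l × ℝ)) :=
  {p | p ∈ atInfinity C ∧
    atInfinity C ∈ 𝓝[(spanAtInfinity C : Set (ℙ ℝ (Space l × ℝ)))] p}

/-- The opposite chamber of an unbounded chamber `C` with respect to its set of points at
infinity: follow a line from a point `p` of `C` to a point `[v : 0]` in the relative interior of
that set (so that `C` contains the ray from `p` in direction `v`) and cross the hyperplane at
infinity there; the chamber entered is the one containing `p - t v` for all large `t`. -/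
def opposite {l : ℕ} (A : Set (AffineSubspace ℝ (Space l))) (C : Set (Space l)) :
    Set (Space l) :=
  {x | x ∈ complement A ∧ ∃ p ∈ C, ∃ (v : Space l) (hv : ((v, 0) : Space l × ℝ) ≠ 0),
    Projectivization.mk ℝ ((v, 0) : Space l × ℝ) hv ∈ relIntAtInfinity C ∧
    (∀ t : ℝ, 0 ≤ t → p + t • v ∈ C) ∧
    ∀ᶠ t : ℝ in atTop, p - t • v ∈ connectedComponentIn (complement A) x}

/-! ### Generic flags near infinity -/

/-- `Fl 0 ⊂ Fl 1 ⊂ ⋯ ⊂ Fl l` is a generic flag near to the hyperplane at infinity (the values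
`Fl k` with `k > l` are irrelevant). In `generic`, dimensions of linear subspaces are used, and
the truncated subtraction expresses that an intersection of negative expected dimension is
empty. -/
structure IsGenericFlagNearInfinity {l : ℕ} (A : Set (AffineSubspace ℝ (Space l)))
    (Fl : ℕ → AffineSubspace ℝ (Space l)) : Prop where
  nonempty : ∀ k ≤ l, (Fl k : Set (Space l)).Nonempty
  finrank_direction : ∀ k ≤ l, Module.finrank ℝ (Fl k).direction = k
  le_succ : ∀ k < l, Fl k ≤ Fl (k + 1)
  top : Fl l = ⊤
  generic : ∀ k ≤ l, ∀ X ∈ projEdges A,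
    Module.finrank ℝ ↥(X ⊓ projClosure (Fl k)) = Module.finrank ℝ X + k - l
  near : ∀ k < l, ∀ x ∈ vertices A (Fl (k + 1)), ∀ y ∈ vertices A (Fl (k + 1)),
    ¬ (Fl k).SOppSide x y

/-- `ch^k`: the chambers that meet `F^k` but not `F^(k-1)` (where `F^(-1)` is empty). -/
def chK {l : ℕ} (A : Set (AffineSubspace ℝ (Space l))) (Fl : ℕ → AffineSubspace ℝ (Space l))
    (k : ℕ) : Set (Set (Space l)) :=
  {C | C ∈ chambers A ∧ (C ∩ (Fl k : Set (Space l))).Nonempty ∧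
    ∀ j, j + 1 = k → C ∩ (Fl j : Set (Space l)) = ∅}

/-- `bch^k`: the chambers `C` in `ch^k` such that `C ∩ F^k` is bounded. -/
def bchK {l : ℕ} (A : Set (AffineSubspace ℝ (Space l))) (Fl : ℕ → AffineSubspace ℝ (Space l))
    (k : ℕ) : Set (Set (Space l)) :=
  {C | C ∈ chK A Fl k ∧ Bornology.IsBounded (C ∩ (Fl k : Set (Space l)))}

/-! ### Degree of a self-map of a sphere -/

open CategoryTheory in
/-- Integral singular homology. -/
def singularH (n : ℕ) : TopCat.{0} ⥤ ModuleCat.{0} ℤ :=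
  (AlgebraicTopology.singularHomologyFunctor (ModuleCat.{0} ℤ) n).obj (ModuleCat.of ℤ ℤ)

open CategoryTheory in
/-- Reduced homology: the kernel of the map to the homology of a point. -/
def reducedH (n : ℕ) (X : TopCat.{0}) : Submodule ℤ ((singularH n).obj X) :=
  LinearMap.ker ((singularH n).map
    (TopCat.ofHom (ContinuousMap.const X PUnit.unit) : X ⟶ TopCat.of PUnit)).hom

open CategoryTheory in
theorem map_mem_reducedH (n : ℕ) {X Y : TopCat.{0}} (f : X ⟶ Y) :
    ∀ z ∈ reducedH n X, ((singularH n).map f).hom z ∈ reducedH n Y := by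
  intro z hz
  have h : f ≫ (TopCat.ofHom (ContinuousMap.const Y PUnit.unit) : Y ⟶ TopCat.of PUnit)
      = TopCat.ofHom (ContinuousMap.const X PUnit.unit) := rfl
  have hz' : ((singularH n).map
    (TopCat.ofHom (ContinuousMap.const X PUnit.unit) : X ⟶ TopCat.of PUnit)).hom z = 0 := hz
  rw [← h, Functor.map_comp] at hz'
  exact hz'

/-- The unit sphere of a normed space, as an object of `TopCat`. -/
abbrev sphereTop (W : Type) [NormedAddCommGroup W] [NormedSpace ℝ W] : TopCat.{0} :=
  TopCat.of (Metric.sphere (0 : W) 1)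

/-- The degree of a continuous self-map `g` of the unit sphere of a `k`-dimensional space
(`k ≥ 1`). The reduced homology of the sphere in degree `k - 1` is infinite cyclic, and `g` acts
on it as multiplication by an integer, the degree; the degree is obtained as the trace of this
endomorphism of a free module of rank one. -/
def sphereDegree (W : Type) [NormedAddCommGroup W] [NormedSpace ℝ W]
    (g : C(Metric.sphere (0 : W) 1, Metric.sphere (0 : W) 1)) : ℤ :=
  LinearMap.trace ℤ (reducedH (Module.finrank ℝ W - 1) (sphereTop W))
    (LinearMap.restrict
      ((singularH (Module.finrank ℝ W - 1)).map
        (TopCat.ofHom g : sphereTop W ⟶ sphereTop W)).hom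
      (map_mem_reducedH (Module.finrank ℝ W - 1) (TopCat.ofHom g : sphereTop W ⟶ sphereTop W)))

/-! ### The degree of a pair of chambers -/

/-- A continuous vector field `U` on `F` is directed to the chamber `D`, relative to the chamber
`C` and to the ball in `F` with center `c` and radius `R`. -/
structure IsDirectedTo {l : ℕ} (A : Set (AffineSubspace ℝ (Space l)))
    (F : AffineSubspace ℝ (Space l)) (C D : Set (Space l)) (c : F) (R : ℝ)
    (U : F → F.direction) : Prop where
  continuous : Continuous U
  /-- `U` has no zeros on the part of the boundary of `C` in the ball. -/
  ne_zero : ∀ x : F, (x : Space l) ∈ frontier (closure C) → dist x c ≤ R → U x ≠ 0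
  /-- On the part of the boundary of the ball in the closure of `C`, `U` points strictly
  inward. -/
  inward : ∀ x : F, (x : Space l) ∈ closure C → dist x c = R →
    0 < inner ℝ (U x : Space l) ((c : Space l) - x)
  /-- On each hyperplane `H`, `U` points strictly to the side of `H` in which `D` lies. -/
  side : ∀ H ∈ A, ∀ x : F, (x : Space l) ∈ H → ∀ y ∈ D,
    H.SSameSide ((x : Space l) + (U x : Space l)) y

/-- Translation of a point of an affine subspace by a vector of its direction. -/
def translate {l : ℕ} (F : AffineSubspace ℝ (Space l)) (w : F.direction) (o : F) : F :=
  ⟨(w : Space l) +ᵥ (o : Space l), AffineSubspace.vadd_mem_of_mem_direction w.2 o.2⟩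

/-- The radial parametrization, from the interior point `o`, of the boundary of the convex body
`closure C ∩ B` in `F`, where `B` is the ball in `F` with center `c` and radius `R`, by the unit
sphere of the direction of `F`. It preserves the orientations that an orientation of `F`
induces on the boundary and on the sphere. -/
def boundaryPoint {l : ℕ} (F : AffineSubspace ℝ (Space l)) (C : Set (Space l)) (c : F) (R : ℝ)
    (o : F) (s : F.direction) : F :=
  translate F
    ((gauge {w : F.direction | (translate F w o : Space l) ∈ closure C ∧
      dist (translate F w o) c ≤ R} s)⁻¹ • s) o

/-- `n` is the degree of the Gauss map `U / |U|` on the boundary of `closure C ∩ B`, for some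
ball `B` in `F` with all `0`-dimensional edges of the arrangement induced on `F` in its interior
and some vector field `U` directed to `D`. -/
def IsChamberDegree {l : ℕ} (A : Set (AffineSubspace ℝ (Space l)))
    (F : AffineSubspace ℝ (Space l)) (C D : Set (Space l)) (n : ℤ) : Prop :=
  ∃ (c : F) (R : ℝ) (U : F → F.direction) (o : F)
    (g : C(Metric.sphere (0 : F.direction) 1, Metric.sphere (0 : F.direction) 1)),
    vertices A F ⊆ Metric.ball (c : Space l) R ∧
    IsDirectedTo A F C D c R U ∧
    (o : Space l) ∈ C ∩ Metric.ball (c : Space l) R ∧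
    (∀ s, (g s : F.direction) = ‖U (boundaryPoint F C c R o s)‖⁻¹ • U (boundaryPoint F C c R o s)) ∧
    sphereDegree F.direction g = n

/-- The degree `deg(C, D)`. It does not depend on the choices in `IsChamberDegree`; if there were
no vector field directed to `D`, its value would be an unspecified integer. -/
def chamberDegree {l : ℕ} (A : Set (AffineSubspace ℝ (Space l)))
    (F : AffineSubspace ℝ (Space l)) (C D : Set (Space l)) : ℤ :=
  Classical.epsilon (IsChamberDegree A F C D)

end RealArrangement

end

noncomputable section

namespace RealArrangement

/-! ### Maps to spheres of degree zero -/

/-! Let `C ≠ C'` be chambers with bounded nonempty sections by `F = {f + d = 0}` and `dim X(C') ≤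
dim X(C)`. To get `deg(C', C^∨) = 0` it suffices to find one field on `F` directed to `C^∨` that has
no zeros on `closure C' ∩ F`. This section is a compact convex set inside every admissible ball, so
its relative boundary lies on hyperplanes of `A`. There, two fields directed to the same chamber
point to the same side, so the segment between them avoids zero; and a field without zeros on a
convex body has a null-homotopic Gauss map (`sphereDegree_eq_zero_of_extends`,
`chamberDegree_eq_zero`).

The field is `U x = p - x + t (w x - v)` with `p ∈ C ∩ F`, `v` in the relative interior of the
recession cone of `C`, `f v = 1`, and `w x` a recession direction of the face through `x`,
continuous in `x`, with `f (w x) = 1`. It is tangent to `F`. If `x ∈ H`, then `w x` is parallel to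
`H`, so `x + U x` lies on the same side of `H` as `p - t v`, a point of `C^∨` for large `t`. The
field `w` exists because all vertices lie on one side of `F`, as genericity and nearness ensure: a
face reaching the other side, or `F` itself, must go to infinity with `f` growing
(`exists_faceRecession`); local choices are glued by convexity.

Zeros on `closure C'` are excluded in two cases (`chamberDegree_opposite_eq_zero`). If `v` is not in
the closed cone `rec C'`, then `w x ∈ rec C'` stays away from `v` and large `t` wins. Otherwise `rec
C ⊆ rec C'`, and the dimension hypothesis makes their spans equal. A hyperplane separating `C` from
`C'` is then parallel to `v`, hence to this common span and to `w x`; along its equation `U x`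
reduces to `p - x`, which is nonzero because `p` lies strictly on the other side from `C'`. -/

open CategoryTheory in
theorem sphereDegree_eq_zero_of_homotopic_const {W : Type} [NormedAddCommGroup W] [NormedSpace ℝ W]
    {g : C(Metric.sphere (0 : W) 1, Metric.sphere (0 : W) 1)} {y : Metric.sphere (0 : W) 1}
    (h : g.Homotopic (ContinuousMap.const _ y)) : sphereDegree W g = 0 := by
  obtain ⟨h⟩ := h
  set n := Module.finrank ℝ W - 1
  let φ : sphereTop W ⟶ sphereTop W := TopCat.ofHom g
  let π : sphereTop W ⟶ TopCat.of PUnit := TopCat.ofHom (ContinuousMap.const _ PUnit.unit)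
  let ι : TopCat.of PUnit ⟶ sphereTop W := TopCat.ofHom (ContinuousMap.const _ y)
  -- A constant map factors through a point, and reduced classes are those that die there.
  have hmap : (singularH n).map φ = (singularH n).map (π ≫ ι) :=
    TopCat.Homotopy.congr_homologyMap_singularChainComplexFunctor
      (f := φ) (g := π ≫ ι) h (ModuleCat.of ℤ ℤ) n
  have hzero : ∀ z ∈ reducedH n (sphereTop W), ((singularH n).map φ).hom z = 0 := by
    intro z hz
    have hz' : ((singularH n).map π).hom z = 0 := hz
    rw [hmap, Functor.map_comp]
    change ((singularH n).map ι).hom (((singularH n).map π).hom z) = 0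
    rw [hz', map_zero]
  unfold sphereDegree
  convert LinearMap.map_zero _
  refine LinearMap.ext fun z => Subtype.ext ?_
  exact hzero z.1 z.2

/-- The map to the unit sphere obtained by normalizing a nowhere vanishing map. -/
def unitMap {X W : Type*} [TopologicalSpace X] [NormedAddCommGroup W] [NormedSpace ℝ W]
    (V : C(X, W)) (hV : ∀ x, V x ≠ 0) : C(X, Metric.sphere (0 : W) 1) where
  toFun x := ⟨‖V x‖⁻¹ • V x, by
    rw [mem_sphere_zero_iff_norm, norm_smul, norm_inv, norm_norm,
      inv_mul_cancel₀ (norm_ne_zero_iff.2 (hV x))]⟩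
  continuous_toFun := by
    refine Continuous.subtype_mk ?_ _
    exact (V.continuous.norm.inv₀ fun x => norm_ne_zero_iff.2 (hV x)).smul V.continuous

/-- A homotopy through nowhere vanishing maps normalizes to a homotopy of maps to the sphere. -/
theorem unitMap_homotopic {X W : Type*} [TopologicalSpace X] [NormedAddCommGroup W]
    [NormedSpace ℝ W] (G : C(unitInterval × X, W)) (hG : ∀ z, G z ≠ 0)
    {g₀ g₁ : C(X, Metric.sphere (0 : W) 1)}
    (h₀ : ∀ x, (g₀ x : W) = ‖G (0, x)‖⁻¹ • G (0, x))
    (h₁ : ∀ x, (g₁ x : W) = ‖G (1, x)‖⁻¹ • G (1, x)) : g₀.Homotopic g₁ :=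
  ⟨{ unitMap G hG with
      map_zero_left := fun x => Subtype.ext (h₀ x).symm
      map_one_left := fun x => Subtype.ext (h₁ x).symm }⟩

/-- If a vector field `V₁` on the boundary of a convex body is homotopic by line segments, through
nowhere vanishing fields, to the restriction of a field `V` without zeros on the body, then its
Gauss map has degree zero. -/
theorem sphereDegree_eq_zero_of_extends {W : Type} [NormedAddCommGroup W] [NormedSpace ℝ W]
    {K : Set W} (hK : Convex ℝ K) (hK₀ : K ∈ 𝓝 0) {β : Metric.sphere (0 : W) 1 → W}
    (hβ : Continuous β) (hβK : ∀ s, β s ∈ K) {V V₁ : W → W} (hV : Continuous V)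
    (hV₁ : Continuous V₁) (hVK : ∀ w ∈ K, V w ≠ 0)
    (hseg : ∀ s, ∀ t ∈ Icc (0 : ℝ) 1, (1 - t) • V₁ (β s) + t • V (β s) ≠ 0)
    {g : C(Metric.sphere (0 : W) 1, Metric.sphere (0 : W) 1)}
    (hg : ∀ s, (g s : W) = ‖V₁ (β s)‖⁻¹ • V₁ (β s)) : sphereDegree W g = 0 := by
  let V' : C(Metric.sphere (0 : W) 1, W) := ⟨fun s => V (β s), hV.comp hβ⟩
  have hV' : ∀ s, V' s ≠ 0 := fun s => hVK _ (hβK s)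
  let V₀ : C(Metric.sphere (0 : W) 1, W) := ⟨fun _ => V 0, continuous_const⟩
  have hV₀ : V 0 ≠ 0 := hVK 0 (mem_of_mem_nhds hK₀)
  have h1 : g.Homotopic (unitMap V' hV') := by
    refine unitMap_homotopic
      ⟨fun z => (1 - (z.1 : ℝ)) • V₁ (β z.2) + (z.1 : ℝ) • V (β z.2), by fun_prop⟩
      (fun z => hseg z.2 z.1 z.1.2) (fun s => ?_) (fun s => ?_)
    · simpa using hg s
    · simp [unitMap, V']
  have h2 : (unitMap V' hV').Homotopic
      (ContinuousMap.const _ ⟨‖V 0‖⁻¹ • V 0, by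
        rw [mem_sphere_zero_iff_norm, norm_smul, norm_inv, norm_norm,
          inv_mul_cancel₀ (norm_ne_zero_iff.2 hV₀)]⟩) := by
    -- Contract the boundary to `0` inside `K`, where `V` has no zeros.
    refine unitMap_homotopic ⟨fun z => V ((1 - (z.1 : ℝ)) • β z.2), by fun_prop⟩
      (fun z => hVK _ ?_) (fun s => ?_) (fun s => ?_)
    · have := hK (hβK z.2) (mem_of_mem_nhds hK₀) (sub_nonneg.2 z.1.2.2) z.1.2.1 (by ring)
      simpa using this
    · simp [unitMap, V']
    · simp
  exact sphereDegree_eq_zero_of_homotopic_const (h1.trans h2)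

/-! ### Equations of hyperplanes -/

/-- `(a, c)` is an equation `a x + c = 0` of the affine subspace `H`. -/
structure IsEquation {l : ℕ} (H : AffineSubspace ℝ (Space l)) (a : Space l →L[ℝ] ℝ) (c : ℝ) :
    Prop where
  ne_zero : a ≠ 0
  mem_iff : ∀ x, x ∈ H ↔ a x + c = 0

theorem IsHyperplane.exists_isEquation {l : ℕ} {H : AffineSubspace ℝ (Space l)}
    (h : IsHyperplane H) : ∃ a c, IsEquation H a c := by
  obtain ⟨⟨q, hq⟩, hdim⟩ := h
  have hlt : H.direction < ⊤ := by
    refine lt_top_iff_ne_top.2 fun htop => ?_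
    rw [htop, finrank_top, finrank_euclideanSpace_fin] at hdim
    omega
  obtain ⟨g, hg0, hgle⟩ := Submodule.exists_le_ker_of_lt_top _ hlt
  have hker : LinearMap.ker g = H.direction := by
    refine (Submodule.eq_of_le_of_finrank_le hgle ?_).symm
    have h1 := LinearMap.finrank_range_add_finrank_ker g
    have h2 : 0 < Module.finrank ℝ (LinearMap.range g) := by
      rw [Module.finrank_pos_iff, Submodule.nontrivial_iff_ne_bot]
      exact fun h => hg0 (LinearMap.range_eq_bot.1 h)
    rw [finrank_euclideanSpace_fin] at h1
    omega
  refine ⟨LinearMap.toContinuousLinearMap g, -g q, fun h => hg0 ?_, fun x => ?_⟩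
  · ext x; exact DFunLike.congr_fun h x
  · rw [← AffineSubspace.vsub_right_mem_direction_iff_mem hq, ← hker, LinearMap.mem_ker,
      vsub_eq_sub, map_sub, sub_eq_add_neg]
    rfl

namespace IsEquation

variable {l : ℕ} {H : AffineSubspace ℝ (Space l)} {a : Space l →L[ℝ] ℝ} {c : ℝ}

theorem mem_direction_iff (h : IsEquation H a c) (hne : (H : Set (Space l)).Nonempty)
    (u : Space l) : u ∈ H.direction ↔ a u = 0 := by
  obtain ⟨q, hq⟩ := hne
  have hq' := (h.mem_iff q).1 hq
  rw [← AffineSubspace.vadd_mem_iff_mem_direction u hq, h.mem_iff, vadd_eq_add, map_add]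
  constructor <;> intro h <;> linarith

theorem sSameSide_iff (h : IsEquation H a c) (hne : (H : Set (Space l)).Nonempty)
    (x y : Space l) : H.SSameSide x y ↔ 0 < (a x + c) * (a y + c) := by
  obtain ⟨q, hq⟩ := hne
  have hq' := (h.mem_iff q).1 hq
  rw [AffineSubspace.sSameSide_iff_exists_left hq, h.mem_iff, h.mem_iff]
  constructor
  · rintro ⟨hx, hy, p, hp, hray⟩
    have hp' := (h.mem_iff p).1 hp
    obtain ⟨r, s, hr, hs, hrs⟩ := hray.exists_pos
      (by rintro e; rw [vsub_eq_zero_iff_eq] at e; exact hx (e ▸ hq'))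
      (by rintro e; rw [vsub_eq_zero_iff_eq] at e; exact hy (e ▸ hp'))
    have e := congrArg a hrs
    simp only [vsub_eq_sub, map_smul, map_sub, smul_eq_mul] at e
    have e' : r * (a x + c) = s * (a y + c) := by linear_combination e + r * hq' - s * hp'
    have : 0 < s * ((a x + c) * (a y + c)) := by
      calc 0 < r * (a x + c) ^ 2 := by positivity
        _ = _ := by linear_combination (a x + c) * e'
    exact (pos_iff_pos_of_mul_pos this).1 hs
  · intro hpos
    have hx : a x + c ≠ 0 := left_ne_zero_of_mul hpos.ne'
    have hy : a y + c ≠ 0 := right_ne_zero_of_mul hpos.ne'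
    have hr : 0 < (a y + c) / (a x + c) := by rw [div_pos_iff, ← mul_pos_iff, mul_comm]; exact hpos
    refine ⟨hx, hy, y - ((a y + c) / (a x + c)) • (x - q), (h.mem_iff _).2 ?_, ?_⟩
    · have : a x - a q = a x + c := by linear_combination -hq'
      rw [map_sub, map_smul, map_sub, this, smul_eq_mul, div_mul_cancel₀ _ hx]
      ring
    · simp only [vsub_eq_sub, sub_sub_cancel]
      exact SameRay.sameRay_nonneg_smul_right _ hr.le

theorem sOppSide_of_mul_neg (h : IsEquation H a c) (hne : (H : Set (Space l)).Nonempty)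
    {x y : Space l} (hxy : (a x + c) * (a y + c) < 0) : H.SOppSide x y := by
  obtain ⟨q, hq⟩ := hne
  have hq' := (h.mem_iff q).1 hq
  have hx : a x + c ≠ 0 := left_ne_zero_of_mul hxy.ne
  have hy : a y + c ≠ 0 := right_ne_zero_of_mul hxy.ne
  have hr : 0 < -((a y + c) / (a x + c)) := by
    rw [neg_pos, div_neg_iff]
    rcases mul_neg_iff.1 hxy with h | h
    · exact Or.inr h.symm
    · exact Or.inl h.symm
  refine ⟨⟨q, hq, y + (-((a y + c) / (a x + c))) • (x - q), (h.mem_iff _).2 ?_, ?_⟩,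
    fun hm => hx ((h.mem_iff _).1 hm), fun hm => hy ((h.mem_iff _).1 hm)⟩
  · have : a x - a q = a x + c := by linear_combination -hq'
    rw [map_add, map_smul, map_sub, this, smul_eq_mul, neg_mul, div_mul_cancel₀ _ hx]
    ring
  · simp only [vsub_eq_sub, add_sub_cancel_left]
    exact SameRay.sameRay_nonneg_smul_right _ hr.le

end IsEquation

/-! ### Recession directions of polyhedra -/

section Polyhedra

variable {E ι : Type*} [NormedAddCommGroup E] [NormedSpace ℝ E]

/-- The arrangement with equations `a i x + c i = 0` has independent enough directions: no line
is parallel to all its members. -/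
def NoLine (a : ι → E →L[ℝ] ℝ) : Prop := ∀ u, (∀ i, a i u = 0) → u = 0

/-- `y` is a vertex of the arrangement induced on the space `f = const`. -/
def IsVertexIn (a : ι → E →L[ℝ] ℝ) (c : ι → ℝ) (f : E →L[ℝ] ℝ) (y : E) : Prop :=
  ∀ u, f u = 0 → (∀ i, a i y + c i = 0 → a i u = 0) → u = 0

/-- `w` is a recession direction of the closed face of the arrangement containing `x` in its
relative interior. -/
def FaceRecession (a : ι → E →L[ℝ] ℝ) (c : ι → ℝ) (x w : E) : Prop :=
  ∀ i, 0 ≤ (a i x + c i) * a i w ∧ (a i x + c i = 0 → a i w = 0)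

/-- The recession cone of the chamber containing `p`. -/
def recCone (a : ι → E →L[ℝ] ℝ) (c : ι → ℝ) (p : E) : Set E :=
  {v | ∀ i, 0 ≤ (a i p + c i) * a i v}

variable {a : ι → E →L[ℝ] ℝ} {c : ι → ℝ} {f : E →L[ℝ] ℝ} {d : ℝ}

/-- A ray that leaves a face does so at a point where a new equation becomes active. -/
theorem exists_first_exit [Finite ι] {x u : E} (hx : ∃ i, (a i x + c i) * a i u < 0) :
    ∃ s : ℝ, 0 < s ∧ (∀ i, 0 ≤ (a i x + c i) * (a i (x + s • u) + c i)) ∧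
      ∃ i, a i x + c i ≠ 0 ∧ a i (x + s • u) + c i = 0 := by
  have hfin : {i | (a i x + c i) * a i u < 0}.Finite := Set.toFinite _
  -- The ratio is the time at which equation `i` vanishes along the ray; the earliest such time is
  -- the exit.
  obtain ⟨i₀, hi₀, hmin⟩ := hfin.exists_minimalFor (fun i => -(a i x + c i) / a i u) _ hx
  have hi₀' : (a i₀ x + c i₀) * a i₀ u < 0 := hi₀
  have hpos : ∀ i, (a i x + c i) * a i u < 0 → 0 < -(a i x + c i) / a i u := by
    intro i hi
    have h1 : a i u ≠ 0 := right_ne_zero_of_mul hi.ne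
    have : -(a i x + c i) / a i u = -((a i x + c i) * a i u) / (a i u) ^ 2 := by
      field_simp
    rw [this]
    exact div_pos (neg_pos.2 hi) (by positivity)
  refine ⟨_, hpos i₀ hi₀, fun i => ?_, i₀, left_ne_zero_of_mul hi₀'.ne, ?_⟩
  · set s := -(a i₀ x + c i₀) / a i₀ u with hs
    have hs0 : 0 < s := hpos i₀ hi₀
    have key : (a i x + c i) * (a i (x + s • u) + c i)
        = (a i x + c i) ^ 2 + s * ((a i x + c i) * a i u) := by
      rw [map_add, map_smul, smul_eq_mul]; ring
    rw [key]
    by_cases hi : (a i x + c i) * a i u < 0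
    · have hle : s ≤ -(a i x + c i) / a i u := by
        by_contra hlt
        exact hlt (hmin hi (le_of_not_ge hlt))
      have h1 : a i u ≠ 0 := right_ne_zero_of_mul hi.ne
      have h2 : -(a i x + c i) / a i u * ((a i x + c i) * a i u) = -(a i x + c i) ^ 2 := by
        field_simp
      have := mul_le_mul_of_nonpos_right hle hi.le
      linarith
    · have := mul_nonneg hs0.le (not_lt.1 hi)
      positivity
  · have h1 : a i₀ u ≠ 0 := right_ne_zero_of_mul hi₀'.ne
    rw [map_add, map_smul, smul_eq_mul, div_mul_cancel₀ _ h1]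
    ring

/-- If all vertices of an arrangement lie in the half space `f + d < 0`, then each face that meets
the complementary half space has a recession direction along which `f` grows. -/
theorem exists_faceRecession [Finite ι] (ha : NoLine a)
    (hv : ∀ y, IsVertexIn a c 0 y → f y + d < 0) (x : E) (hx : 0 ≤ f x + d) :
    ∃ w, f w = 1 ∧ FaceRecession a c x w := by
  -- Induction on the number of equations not vanishing at `x`. Since `x` is not a vertex, one can
  -- move inside its face without decreasing `f`: either forever with `f` growing, or until a
  -- further equation vanishes.
  induction hn : {i | a i x + c i ≠ 0}.ncard using Nat.strong_induction_on generalizing x with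
  | _ n ih =>
  have hnv : ¬ IsVertexIn a c 0 x := fun h => absurd (hv x h) (not_lt.2 hx)
  unfold IsVertexIn at hnv
  push Not at hnv
  obtain ⟨u₀, -, hu₀, hne₀⟩ := hnv
  obtain ⟨u, hu, hne, hfu⟩ : ∃ u, (∀ i, a i x + c i = 0 → a i u = 0) ∧ u ≠ 0 ∧ 0 ≤ f u := by
    rcases le_total 0 (f u₀) with h | h
    · exact ⟨u₀, hu₀, hne₀, h⟩
    · exact ⟨-u₀, fun i hi => by rw [map_neg, hu₀ i hi, neg_zero], neg_ne_zero.2 hne₀,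
        by rw [map_neg]; linarith⟩
  by_cases hdone : 0 < f u ∧ ∀ i, 0 ≤ (a i x + c i) * a i u
  · refine ⟨(f u)⁻¹ • u, ?_, fun i => ⟨?_, fun hi => ?_⟩⟩
    · rw [map_smul, smul_eq_mul, inv_mul_cancel₀ hdone.1.ne']
    · rw [map_smul, smul_eq_mul, mul_left_comm]
      exact mul_nonneg (inv_nonneg.2 hdone.1.le) (hdone.2 i)
    · rw [map_smul, hu i hi, smul_zero]
  -- If `u` never leaves the face, then `f u = 0`, and `-u` serves instead: it must leave, since
  -- `NoLine` gives an equation nonzero on `u`.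
  obtain ⟨u', hu', hfu', hex⟩ : ∃ u', (∀ i, a i x + c i = 0 → a i u' = 0) ∧ 0 ≤ f u' ∧
      ∃ i, (a i x + c i) * a i u' < 0 := by
    by_cases hall : ∀ i, 0 ≤ (a i x + c i) * a i u
    · have hf0 : f u = 0 := le_antisymm (not_lt.1 fun h => hdone ⟨h, hall⟩) hfu
      obtain ⟨i, hi⟩ : ∃ i, a i u ≠ 0 := by
        by_contra! h
        exact hne (ha u h)
      refine ⟨-u, fun i hi => by rw [map_neg, hu i hi, neg_zero], by rw [map_neg, hf0, neg_zero],
        i, ?_⟩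
      have : (a i x + c i) * a i u ≠ 0 := mul_ne_zero (fun h => hi (hu i h)) hi
      have := lt_of_le_of_ne (hall i) this.symm
      rw [map_neg, mul_neg]
      linarith
    · push Not at hall
      exact ⟨u, hu, hfu, hall⟩
  obtain ⟨s, hs, hside, i₁, hi₁, hi₁'⟩ := exists_first_exit hex
  have hact : ∀ i, a i x + c i = 0 → a i (x + s • u') + c i = 0 := by
    intro i hi
    rw [map_add, map_smul, hu' i hi, smul_zero, add_zero, hi]
  have hlt : {i | a i (x + s • u') + c i ≠ 0}.ncard < n := by
    rw [← hn]
    refine Set.ncard_lt_ncard ⟨fun i hi h => hi (hact i h), fun hsub => ?_⟩ (Set.toFinite _)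
    exact hsub hi₁ hi₁'
  have hfy : 0 ≤ f (x + s • u') + d := by
    rw [map_add, map_smul, smul_eq_mul]
    have := mul_nonneg hs.le hfu'
    linarith
  obtain ⟨w, hw1, hw⟩ := ih _ hlt _ hfy rfl
  -- The exit point lies in the closed face of `x`, so recession directions of its own face are
  -- inherited by the face of `x`.
  refine ⟨w, hw1, fun i => ⟨?_, fun hi => (hw i).2 (hact i hi)⟩⟩
  by_cases hy : a i (x + s • u') + c i = 0
  · rw [(hw i).2 hy, mul_zero]
  · have h1 : 0 < (a i x + c i) * (a i (x + s • u') + c i) :=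
      lt_of_le_of_ne (hside i) (mul_ne_zero (fun h => hy (hact i h)) hy).symm
    have h2 := mul_nonneg h1.le (hw i).1
    have h3 : 0 ≤ (a i (x + s • u') + c i) ^ 2 * ((a i x + c i) * a i w) := by
      calc _ ≤ _ := h2
        _ = _ := by ring
    exact nonneg_of_mul_nonneg_right h3 (by positivity)

/-- Recession directions of faces can be chosen continuously. -/
theorem exists_continuous_faceRecession [Finite ι] {F : Set E}
    (h : ∀ x ∈ F, ∃ w, f w = 1 ∧ FaceRecession a c x w) :
    ∃ w : C(F, E), ∀ x : F, f (w x) = 1 ∧ FaceRecession a c (x : E) (w x) := by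
  refine exists_continuous_forall_mem_convex_of_local_const
    (t := fun x : F => {w | f w = 1 ∧ FaceRecession a c (x : E) w}) (fun x => ?_) (fun x => ?_)
  · rintro v ⟨hv, hv'⟩ w ⟨hw, hw'⟩ r s hr hs hrs
    refine ⟨by simp [hv, hw, hrs], fun i => ⟨?_, fun hi => ?_⟩⟩
    · have h1 := mul_nonneg hr (hv' i).1
      have h2 := mul_nonneg hs (hw' i).1
      simp only [map_add, map_smul, smul_eq_mul]
      linarith
    · simp [(hv' i).2 hi, (hw' i).2 hi]
  · obtain ⟨w, hw1, hw⟩ := h x x.2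
    -- Near `x` the nonzero equations keep their signs, so `x` is in the closed face of `y` and the
    -- constant `w` remains admissible.
    have hev : ∀ᶠ y : F in 𝓝 x, ∀ i, a i x + c i ≠ 0 →
        0 < (a i x + c i) * (a i (y : E) + c i) := by
      rw [eventually_all]
      intro i
      by_cases hi : a i x + c i = 0
      · exact Eventually.of_forall fun _ h => absurd hi h
      · have hc : Continuous fun y : F => (a i x + c i) * (a i (y : E) + c i) := by fun_prop
        have := (hc.tendsto x).eventually (lt_mem_nhds (mul_self_pos.2 hi))
        exact this.mono fun y hy _ => hy
    refine ⟨w, hev.mono fun y hy => ⟨hw1, fun i => ?_⟩⟩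
    by_cases hi : a i x + c i = 0
    · simp [(hw i).2 hi]
    · have h1 := hy i hi
      refine ⟨?_, fun h => absurd h (right_ne_zero_of_mul h1.ne')⟩
      have h2 := mul_nonneg h1.le (hw i).1
      have h3 : 0 ≤ (a i x + c i) ^ 2 * ((a i (y : E) + c i) * a i w) := by
        calc _ ≤ _ := h2
          _ = _ := by ring
      exact nonneg_of_mul_nonneg_right h3 (by positivity)

/-- The equations nonzero at `x` have the sign they have at `p`, and the others vanish on `w`. -/
theorem FaceRecession.mem_recCone {p x w : E} (hw : FaceRecession a c x w)
    (hx : ∀ i, 0 ≤ (a i p + c i) * (a i x + c i)) : w ∈ recCone a c p := by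
  intro i
  by_cases hi : a i x + c i = 0
  · rw [(hw i).2 hi, mul_zero]
  · have h2 := mul_nonneg (hx i) (hw i).1
    have h3 : 0 ≤ (a i x + c i) ^ 2 * ((a i p + c i) * a i w) := by
      calc _ ≤ _ := h2
        _ = _ := by ring
    exact nonneg_of_mul_nonneg_right h3 (by positivity)

theorem isClosed_recCone (p : E) : IsClosed (recCone a c p) := by
  simp only [recCone, ofPred_forall]
  exact isClosed_iInter fun i => isClosed_le continuous_const (by fun_prop)

theorem recCone_add_mem {p v w : E} (hv : v ∈ recCone a c p) (hw : w ∈ recCone a c p) :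
    v + w ∈ recCone a c p := by
  intro i
  have := hv i
  have := hw i
  rw [map_add]
  linarith

theorem recCone_smul_mem {p v : E} {t : ℝ} (ht : 0 ≤ t) (hv : v ∈ recCone a c p) :
    t • v ∈ recCone a c p := by
  intro i
  rw [map_smul, smul_eq_mul, mul_left_comm]
  exact mul_nonneg ht (hv i)

theorem eq_zero_of_mem_recCone_of_neg_mem (ha : NoLine a) {p v : E}
    (hp : ∀ i, a i p + c i ≠ 0) (hv : v ∈ recCone a c p) (hv' : -v ∈ recCone a c p) : v = 0 := by
  refine ha v fun i => ?_
  have h1 := hv i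
  have h2 := hv' i
  rw [map_neg] at h2
  have : (a i p + c i) * a i v = 0 := by linarith
  exact (mul_eq_zero.1 this).resolve_left (hp i)

theorem chamber_add_recCone {p x v : E} (hx : ∀ i, 0 < (a i p + c i) * (a i x + c i))
    (hv : v ∈ recCone a c p) : ∀ i, 0 < (a i p + c i) * (a i (x + v) + c i) := by
  intro i
  have := hx i
  have := hv i
  rw [map_add]
  linarith

/-- If the section of a chamber by `f + d = 0` is bounded and nonempty, and `f` grows along some
recession direction, it grows along all of them. -/
theorem pos_of_mem_recCone (ha : NoLine a) {p w : E} (hp : ∀ i, a i p + c i ≠ 0)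
    (hpF : f p + d = 0)
    (hbd : Bornology.IsBounded {x | f x + d = 0 ∧ ∀ i, 0 < (a i p + c i) * (a i x + c i)})
    (hw : w ∈ recCone a c p) (hw1 : f w = 1) {v : E} (hv : v ∈ recCone a c p) (hv0 : v ≠ 0) :
    0 < f v := by
  -- A nonzero recession direction tangent to the section would put a whole ray from `p` into it.
  have key : ∀ r ∈ recCone a c p, f r = 0 → r = 0 := by
    intro r hr hfr
    by_contra hr0
    obtain ⟨M, hM⟩ := hbd.exists_norm_le
    have hb : ∀ t : ℝ, 0 ≤ t → ‖p + t • r‖ ≤ M := fun t ht => hM _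
      ⟨by rw [map_add, map_smul, hfr, smul_zero, add_zero, hpF],
        chamber_add_recCone (fun i => mul_self_pos.2 (hp i)) (recCone_smul_mem ht hr)⟩
    have hM0 : 0 ≤ M := (norm_nonneg _).trans (hb 0 le_rfl)
    have hrpos : 0 < ‖r‖ := norm_pos_iff.2 hr0
    have h1 := hb ((M + ‖p‖ + 1) / ‖r‖) (by positivity)
    have h2 : ‖((M + ‖p‖ + 1) / ‖r‖) • r‖ = M + ‖p‖ + 1 := by
      rw [norm_smul, Real.norm_of_nonneg (by positivity), div_mul_cancel₀ _ hrpos.ne']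
    have h3 := norm_sub_le (p + ((M + ‖p‖ + 1) / ‖r‖) • r) p
    rw [add_sub_cancel_left, h2] at h3
    linarith
  by_contra hneg
  -- When `f v ≤ 0`, this combination stays in the cone and is killed by `f`. Hence `-v` is in the
  -- cone as well, against pointedness.
  have h1 : v + (-f v) • w = 0 := by
    refine key _ (recCone_add_mem hv (recCone_smul_mem (by linarith) hw)) ?_
    rw [map_add, map_smul, hw1, smul_eq_mul]
    ring
  refine hv0 (eq_zero_of_mem_recCone_of_neg_mem ha hp hv ?_)
  have : -v = (-f v) • w := by rw [neg_eq_iff_add_eq_zero.2 h1]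
  rw [this]
  exact recCone_smul_mem (by linarith) hw

/-- A point of the closed chamber is a limit of points of the open chamber. -/
theorem segment_mem_chamber {p x : E} (hp : ∀ i, a i p + c i ≠ 0)
    (hx : ∀ i, 0 ≤ (a i p + c i) * (a i x + c i)) {t : ℝ} (ht : 0 < t) (ht1 : t ≤ 1) (i : ι) :
    0 < (a i p + c i) * (a i (x + t • (p - x)) + c i) := by
  have h1 := mul_pos ht (mul_self_pos.2 (hp i))
  have h2 := mul_nonneg (sub_nonneg.2 ht1) (hx i)
  have : (a i p + c i) * (a i (x + t • (p - x)) + c i)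
      = t * ((a i p + c i) * (a i p + c i)) + (1 - t) * ((a i p + c i) * (a i x + c i)) := by
    rw [map_add, map_smul, map_sub, smul_eq_mul]; ring
  rw [this]
  linarith

theorem mem_closure_of_segment {S : Set E} {p x : E}
    (h : ∀ t : ℝ, 0 < t → t ≤ 1 → x + t • (p - x) ∈ S) : x ∈ closure S := by
  have hc : Continuous fun t : ℝ => x + t • (p - x) := by fun_prop
  have ht : Tendsto (fun t : ℝ => x + t • (p - x)) (𝓝[>] 0) (𝓝 x) := by
    have := (hc.tendsto 0).mono_left (nhdsWithin_le_nhds (s := Ioi 0))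
    simpa using this
  refine mem_closure_of_tendsto ht ?_
  filter_upwards [Ioc_mem_nhdsGT (zero_lt_one' ℝ)] with t ht
  exact h t ht.1 ht.2

theorem isBounded_closed_section {p : E} (hp : ∀ i, a i p + c i ≠ 0) (hpF : f p + d = 0)
    (hbd : Bornology.IsBounded {x | f x + d = 0 ∧ ∀ i, 0 < (a i p + c i) * (a i x + c i)}) :
    Bornology.IsBounded {x | f x + d = 0 ∧ ∀ i, 0 ≤ (a i p + c i) * (a i x + c i)} := by
  refine hbd.closure.subset ?_
  rintro x ⟨hxF, hx⟩
  refine mem_closure_of_segment (p := p) fun t ht ht1 => ⟨?_, segment_mem_chamber hp hx ht ht1⟩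
  rw [map_add, map_smul, map_sub, smul_eq_mul]
  linear_combination (1 - t) * hxF + t * hpF

end Polyhedra

/-- A bounded closed polyhedron is contained in each ball that contains the vertices. -/
theorem closed_section_subset_ball {E ι : Type*} [NormedAddCommGroup E] [InnerProductSpace ℝ E]
    [FiniteDimensional ℝ E] [Finite ι] {a : ι → E →L[ℝ] ℝ} {c : ι → ℝ} {f : E →L[ℝ] ℝ} {d : ℝ}
    {p : E}
    (hbd : Bornology.IsBounded {x | f x + d = 0 ∧ ∀ i, 0 ≤ (a i p + c i) * (a i x + c i)})
    {z : E} {R : ℝ} (hv : ∀ y, f y + d = 0 → IsVertexIn a c f y → dist y z < R) :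
    ∀ x, f x + d = 0 → (∀ i, 0 ≤ (a i p + c i) * (a i x + c i)) → dist x z < R := by
  set Q := {x | f x + d = 0 ∧ ∀ i, 0 ≤ (a i p + c i) * (a i x + c i)} with hQ
  have hcl : IsClosed Q := by
    rw [hQ, ofPred_and, ofPred_forall]
    exact (isClosed_eq (by fun_prop) continuous_const).inter
      (isClosed_iInter fun i => isClosed_le continuous_const (by fun_prop))
  intro x hxF hx
  -- A point farthest from `z` is a vertex: otherwise one could move from it both ways along a line
  -- in `Q`, and by the parallelogram law one of the two moves increases the distance.
  obtain ⟨y, hyQ, hmax⟩ := (Metric.isCompact_of_isClosed_isBounded hcl hbd).exists_isMaxOn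
    ⟨x, hxF, hx⟩ (f := fun y => dist y z) (by fun_prop)
  refine lt_of_le_of_lt (hmax (show x ∈ Q from ⟨hxF, hx⟩)) (hv y hyQ.1 ?_)
  intro u hfu hu
  by_contra hu0
  have hline : ∀ᶠ s : ℝ in 𝓝 0, y + s • u ∈ Q := by
    have hall : ∀ᶠ s : ℝ in 𝓝 0, ∀ i, 0 ≤ (a i p + c i) * (a i (y + s • u) + c i) := by
      rw [eventually_all]
      intro i
      by_cases hi : a i y + c i = 0
      · refine Eventually.of_forall fun s => ?_
        rw [map_add, map_smul, hu i hi, smul_zero, add_zero, hi, mul_zero]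
      · by_cases hpi : a i p + c i = 0
        · simp [hpi]
        · have hc : Continuous fun s : ℝ => (a i p + c i) * (a i (y + s • u) + c i) := by fun_prop
          have hpos : 0 < (a i p + c i) * (a i (y + (0 : ℝ) • u) + c i) := by
            rw [zero_smul, add_zero]
            exact lt_of_le_of_ne (hyQ.2 i) (mul_ne_zero hpi hi).symm
          exact ((hc.tendsto 0).eventually (lt_mem_nhds hpos)).mono fun s hs => hs.le
    refine hall.mono fun s hs => ⟨?_, hs⟩
    rw [map_add, map_smul, hfu, smul_zero, add_zero, hyQ.1]
  have hneg : ∀ᶠ s : ℝ in 𝓝 0, y + (-s) • u ∈ Q := by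
    have : Tendsto (fun s : ℝ => -s) (𝓝 0) (𝓝 0) := by
      simpa using (continuous_neg (G := ℝ)).tendsto 0
    exact this.eventually hline
  obtain ⟨s, ⟨h1, h2⟩, hs⟩ :=
    (((hline.and hneg).filter_mono nhdsWithin_le_nhds).and
      (self_mem_nhdsWithin (s := Ioi (0 : ℝ)) (a := 0))).exists
  have hs : 0 < s := hs
  have d1 : dist (y + s • u) z ≤ dist y z := hmax h1
  have d2 : dist (y + (-s) • u) z ≤ dist y z := hmax h2
  rw [dist_eq_norm, dist_eq_norm] at d1 d2
  have e1 : y + s • u - z = (y - z) + s • u := by abel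
  have e2 : y + (-s) • u - z = (y - z) - s • u := by rw [neg_smul]; abel
  rw [e1] at d1
  rw [e2] at d2
  have hpar := parallelogram_law_with_norm ℝ (y - z) (s • u)
  have hsu : 0 < ‖s • u‖ := norm_pos_iff.2 (smul_ne_zero hs.ne' hu0)
  have m1 := mul_self_le_mul_self (norm_nonneg _) d1
  have m2 := mul_self_le_mul_self (norm_nonneg _) d2
  nlinarith [mul_pos hsu hsu]

/-! ### Chambers in terms of equations -/

section Chambers

variable {l : ℕ} {A : Set (AffineSubspace ℝ (Space l))} {a : A → Space l →L[ℝ] ℝ} {c : A → ℝ}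

theorem mem_complement_iff (heq : ∀ H : A, IsEquation H.1 (a H) (c H)) {x : Space l} :
    x ∈ complement A ↔ ∀ H, a H x + c H ≠ 0 :=
  ⟨fun h H e => h H.1 H.2 (((heq H).mem_iff x).2 e),
    fun h H hH e => h ⟨H, hH⟩ (((heq ⟨H, hH⟩).mem_iff x).1 e)⟩

theorem convex_signs (p : Space l) : Convex ℝ {x | ∀ H, 0 < (a H p + c H) * (a H x + c H)} := by
  rintro x hx y hy r s hr hs hrs H
  have h1 := hx H
  have h2 := hy H
  have e : (a H p + c H) * (a H (r • x + s • y) + c H)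
      = r * ((a H p + c H) * (a H x + c H)) + s * ((a H p + c H) * (a H y + c H)) := by
    simp only [map_add, map_smul, smul_eq_mul]
    linear_combination -(a H p + c H) * c H * hrs
  rw [e]
  rcases hr.eq_or_lt with rfl | hr
  · rw [zero_add] at hrs
    rw [hrs]; linarith
  · have := mul_pos hr h1
    have := mul_nonneg hs h2.le
    linarith

theorem isOpen_signs [Finite A] (p : Space l) :
    IsOpen {x | ∀ H, 0 < (a H p + c H) * (a H x + c H)} := by
  simp only [ofPred_forall]
  exact isOpen_iInter_of_finite fun H => isOpen_lt continuous_const (by fun_prop)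

/-- An equation cannot change sign on a connected set that avoids its zeros, and conversely a sign
cell is convex. -/
theorem connectedComponentIn_complement (heq : ∀ H : A, IsEquation H.1 (a H) (c H)) {x : Space l}
    (hx : x ∈ complement A) :
    connectedComponentIn (complement A) x = {y | ∀ H, 0 < (a H x + c H) * (a H y + c H)} := by
  have hx' := (mem_complement_iff heq).1 hx
  apply Subset.antisymm
  · intro y hy H
    by_contra hneg
    have hpre := isPreconnected_connectedComponentIn (F := complement A) (x := x)
    have hxm := mem_connectedComponentIn hx
    have hcont : ContinuousOn (fun z => (a H x + c H) * (a H z + c H))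
        (connectedComponentIn (complement A) x) := by fun_prop
    obtain ⟨z, hz, hz0⟩ := hpre.intermediate_value hy hxm hcont
      ⟨not_lt.1 hneg, (mul_self_pos.2 (hx' H)).le⟩
    exact (mem_complement_iff heq).1 (connectedComponentIn_subset _ _ hz) H
      ((mul_eq_zero.1 hz0).resolve_left (hx' H))
  · refine (convex_signs x).isPreconnected.subset_connectedComponentIn
      (fun H => mul_self_pos.2 (hx' H)) fun y hy => ?_
    exact (mem_complement_iff heq).2 fun H => right_ne_zero_of_mul (hy H).ne'

theorem chamber_eq (heq : ∀ H : A, IsEquation H.1 (a H) (c H)) {C : Set (Space l)}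
    (hC : C ∈ chambers A) {p : Space l} (hp : p ∈ C) :
    (∀ H, a H p + c H ≠ 0) ∧ C = {y | ∀ H, 0 < (a H p + c H) * (a H y + c H)} := by
  obtain ⟨x, hx, rfl⟩ := hC
  have hp' := connectedComponentIn_subset _ _ hp
  exact ⟨(mem_complement_iff heq).1 hp', by
    rw [connectedComponentIn_eq hp, connectedComponentIn_complement heq hp']⟩

theorem closure_signs {p : Space l} (hp : ∀ H, a H p + c H ≠ 0) :
    closure {x | ∀ H, 0 < (a H p + c H) * (a H x + c H)}
      = {x | ∀ H, 0 ≤ (a H p + c H) * (a H x + c H)} := by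
  apply Subset.antisymm
  · refine closure_minimal (fun x hx H => (hx H).le) ?_
    simp only [ofPred_forall]
    exact isClosed_iInter fun H => isClosed_le continuous_const (by fun_prop)
  · intro x hx
    exact mem_closure_of_segment (p := p) fun t ht ht1 => segment_mem_chamber hp hx ht ht1

theorem finite_vertices (hA : A.Finite) (F : AffineSubspace ℝ (Space l)) :
    (vertices A F).Finite := by
  refine (hA.finite_subsets.biUnion
    (t := fun S => {x | (⋂ H ∈ S, (H : Set (Space l))) ∩ (F : Set (Space l)) = {x}})
    fun S _ => ?_).subset fun x ⟨S, hS, hx⟩ => mem_iUnion₂.2 ⟨S, hS, hx⟩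
  refine Set.Subsingleton.finite fun x hx y hy => ?_
  exact singleton_injective ((show _ = _ from hx).symm.trans hy)

/-- The witness is the set of all members of `A` through `y`. Taking `f = 0` and `d = 0` covers `F =
⊤`. -/
theorem mem_vertices_of_isVertexIn (heq : ∀ H : A, IsEquation H.1 (a H) (c H))
    {F : AffineSubspace ℝ (Space l)} {f : Space l →L[ℝ] ℝ} {d : ℝ}
    (hF : ∀ x, x ∈ F ↔ f x + d = 0) {y : Space l} (hyF : y ∈ F) (hy : IsVertexIn a c f y) :
    y ∈ vertices A F := by
  refine ⟨{H ∈ A | y ∈ H}, fun H hH => hH.1, Subset.antisymm ?_ ?_⟩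
  · rintro z ⟨hz, hzF⟩
    have hz' : ∀ H ∈ A, y ∈ H → z ∈ H := fun H hH hy => mem_iInter₂.1 hz H ⟨hH, hy⟩
    refine sub_eq_zero.1 (hy (z - y) ?_ fun H hH => ?_)
    · rw [map_sub]
      linear_combination (hF z).1 hzF - (hF y).1 hyF
    · have := ((heq H).mem_iff z).1 (hz' H H.2 (((heq H).mem_iff y).2 hH))
      rw [map_sub]
      linear_combination this - hH
  · rintro _ rfl
    exact ⟨mem_iInter₂.2 fun H hH => hH.2, hyF⟩

end Chambers

/-! ### The boundary of the convex body -/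

section Body

variable {l : ℕ} {F : AffineSubspace ℝ (Space l)} {C : Set (Space l)} {c : F} {R : ℝ} {o : F}

/-- The convex body `closure C ∩ B` of `F`, seen from the point `o`. -/
def body (F : AffineSubspace ℝ (Space l)) (C : Set (Space l)) (c : F) (R : ℝ) (o : F) :
    Set F.direction :=
  {w | (translate F w o : Space l) ∈ closure C ∧ dist (translate F w o) c ≤ R}

/-- The radial projection of the unit sphere to the boundary of `body`. -/
def radial (F : AffineSubspace ℝ (Space l)) (C : Set (Space l)) (c : F) (R : ℝ) (o : F)
    (s : F.direction) : F.direction :=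
  (gauge (body F C c R o) s)⁻¹ • s

theorem continuous_translate (o : F) : Continuous fun w => translate F w o := by
  refine Continuous.subtype_mk ?_ _
  exact (continuous_subtype_val.vadd continuous_const)

theorem translate_zero (o : F) : translate F 0 o = o := by
  apply Subtype.ext
  simp [translate]

theorem convex_body (hC : Convex ℝ C) : Convex ℝ (body F C c R o) := by
  have h : Convex ℝ (closure C ∩ Metric.closedBall (c : Space l) R) :=
    hC.closure.inter (convex_closedBall _ _)
  have h' := (h.translate_preimage_left (o : Space l)).linear_preimage F.direction.subtype
  exact h'

theorem body_mem_nhds (hC : IsOpen C) (ho : (o : Space l) ∈ C ∩ Metric.ball (c : Space l) R) :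
    body F C c R o ∈ 𝓝 0 := by
  have hc : Continuous fun w : F.direction => (translate F w o : Space l) :=
    continuous_subtype_val.comp (continuous_translate o)
  have hopen : IsOpen (C ∩ Metric.ball (c : Space l) R) := hC.inter Metric.isOpen_ball
  have h0 : (translate F 0 o : Space l) ∈ C ∩ Metric.ball (c : Space l) R := by
    rwa [translate_zero]
  filter_upwards [(hopen.preimage hc).mem_nhds h0] with w hw
  exact ⟨subset_closure hw.1, (Metric.mem_ball.1 hw.2).le⟩

theorem isClosed_body : IsClosed (body F C c R o) := by
  have hc := continuous_translate o
  exact (isClosed_closure.preimage (continuous_subtype_val.comp hc)).inter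
    (isClosed_le (hc.dist continuous_const) continuous_const)

theorem isBounded_body : Bornology.IsBounded (body F C c R o) := by
  refine (Metric.isBounded_closedBall (x := (0 : F.direction)) (r := R + dist o c)).subset ?_
  rintro w ⟨-, hw⟩
  rw [mem_closedBall_zero_iff]
  have h1 : dist (translate F w o) o = ‖w‖ := by
    rw [Subtype.dist_eq, dist_eq_norm]
    simp [translate]
  have h2 := dist_triangle_right (translate F w o) o c
  linarith


theorem gauge_body_pos (hCopen : IsOpen C)
    (ho : (o : Space l) ∈ C ∩ Metric.ball (c : Space l) R) (s : Metric.sphere (0 : F.direction) 1) :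
    0 < gauge (body F C c R o) (s : F.direction) := by
  rw [gauge_pos (absorbent_nhds_zero (body_mem_nhds hCopen ho))
    (NormedSpace.isVonNBounded_of_isBounded ℝ isBounded_body)]
  rintro h
  have := mem_sphere_zero_iff_norm.1 s.2
  rw [h, norm_zero] at this
  exact zero_ne_one this

theorem continuous_radial (hCconv : Convex ℝ C) (hCopen : IsOpen C)
    (ho : (o : Space l) ∈ C ∩ Metric.ball (c : Space l) R) :
    Continuous fun s : Metric.sphere (0 : F.direction) 1 => radial F C c R o s := by
  have h := (continuous_gauge (convex_body hCconv) (body_mem_nhds hCopen ho)).comp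
    (continuous_subtype_val (p := fun s => s ∈ Metric.sphere (0 : F.direction) 1))
  exact (h.inv₀ fun s => (gauge_body_pos hCopen ho s).ne').smul continuous_subtype_val

theorem radial_mem_frontier (hCconv : Convex ℝ C) (hCopen : IsOpen C)
    (ho : (o : Space l) ∈ C ∩ Metric.ball (c : Space l) R)
    (s : Metric.sphere (0 : F.direction) 1) :
    radial F C c R o s ∈ frontier (body F C c R o) := by
  have h := gauge_body_pos hCopen ho s
  rw [← gauge_eq_one_iff_mem_frontier (convex_body hCconv) (body_mem_nhds hCopen ho), radial,
    gauge_smul_of_nonneg (inv_nonneg.2 h.le), smul_eq_mul, inv_mul_cancel₀ h.ne']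

theorem radial_mem_body (hCconv : Convex ℝ C) (hCopen : IsOpen C)
    (ho : (o : Space l) ∈ C ∩ Metric.ball (c : Space l) R)
    (s : Metric.sphere (0 : F.direction) 1) : radial F C c R o s ∈ body F C c R o :=
  isClosed_body.frontier_subset (radial_mem_frontier hCconv hCopen ho s)

/-- Since the closed section stays strictly inside the ball, only the walls of `C` bound the body: a
point of the open set `C` would be interior to it. -/
theorem translate_radial_notMem (hCconv : Convex ℝ C) (hCopen : IsOpen C)
    (ho : (o : Space l) ∈ C ∩ Metric.ball (c : Space l) R)
    (hball : ∀ x : F, (x : Space l) ∈ closure C → dist (x : Space l) c < R)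
    (s : Metric.sphere (0 : F.direction) 1) :
    (translate F (radial F C c R o s) o : Space l) ∉ C := by
  intro hmem
  refine (radial_mem_frontier hCconv hCopen ho s).2 ?_
  have hc : Continuous fun w : F.direction => (translate F w o : Space l) :=
    continuous_subtype_val.comp (continuous_translate o)
  rw [mem_interior_iff_mem_nhds]
  filter_upwards [(hCopen.preimage hc).mem_nhds hmem] with w hw
  exact ⟨subset_closure hw, (hball _ (subset_closure hw)).le⟩

end Body

/-! ### Vanishing of the degree -/

/-- If there is a vector field directed to `D` that has no zeros on the compact set
`closure C ∩ F`, then `deg(C, D) = 0`. -/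
theorem chamberDegree_eq_zero {l : ℕ} {A : Set (AffineSubspace ℝ (Space l))} (hA : A.Finite)
    {a : A → Space l →L[ℝ] ℝ} {c : A → ℝ} (heq : ∀ H : A, IsEquation H.1 (a H) (c H))
    (hne : ∀ H ∈ A, (H : Set (Space l)).Nonempty)
    {F : AffineSubspace ℝ (Space l)} {f : Space l →L[ℝ] ℝ} {d : ℝ}
    (hF : ∀ x, x ∈ F ↔ f x + d = 0) {C D : Set (Space l)} (hC : C ∈ chambers A) {p : Space l}
    (hpC : p ∈ C) (hpF : p ∈ F) (hbd : Bornology.IsBounded (C ∩ (F : Set (Space l))))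
    (hD : D.Nonempty) {U : F → F.direction} (hU : Continuous U)
    (hside : ∀ H ∈ A, ∀ x : F, (x : Space l) ∈ H → ∀ y ∈ D,
      H.SSameSide ((x : Space l) + (U x : Space l)) y)
    (hU0 : ∀ x : F, (x : Space l) ∈ closure C → U x ≠ 0) :
    chamberDegree A F C D = 0 := by
  have : Finite A := hA
  obtain ⟨hp, hCeq⟩ := chamber_eq heq hC hpC
  have hCconv : Convex ℝ C := by rw [hCeq]; exact convex_signs p
  have hCopen : IsOpen C := by rw [hCeq]; exact isOpen_signs p
  have hcl : closure C = {x | ∀ H, 0 ≤ (a H p + c H) * (a H x + c H)} := by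
    conv_lhs => rw [hCeq]
    exact closure_signs hp
  have hbd' : Bornology.IsBounded {x | f x + d = 0 ∧
      ∀ H, 0 ≤ (a H p + c H) * (a H x + c H)} := by
    refine isBounded_closed_section hp ((hF p).1 hpF) (hbd.subset ?_)
    rintro x ⟨hxF, hx⟩
    refine ⟨?_, (hF x).2 hxF⟩
    rw [hCeq]
    exact hx
  -- points of the closed chamber outside the chamber lie on a hyperplane
  have hwall : ∀ x ∈ closure C, x ∉ C → ∃ H : A, x ∈ H.1 := by
    intro x hx hxC
    by_contra! hno
    refine hxC ?_
    rw [hcl] at hx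
    rw [hCeq]
    intro H
    refine lt_of_le_of_ne (hx H) (mul_ne_zero (hp H) fun h => ?_).symm
    exact hno H (((heq H).mem_iff x).2 h)
  -- The degree is a value of `Classical.epsilon`, so two things are needed: every admissible choice
  -- gives `0`, and an admissible choice exists.
  have hzero : ∀ n, IsChamberDegree A F C D n → n = 0 := by
    rintro n ⟨z, R, U₁, o, g, hvert, hdir, ho, hg, rfl⟩
    have hball : ∀ x : F, (x : Space l) ∈ closure C → dist (x : Space l) z < R := by
      intro x hx
      rw [hcl] at hx
      refine closed_section_subset_ball hbd' (fun y hyF hy => ?_) x ((hF x).1 x.2) hx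
      exact Metric.mem_ball.1 (hvert (mem_vertices_of_isVertexIn heq hF ((hF y).2 hyF) hy))
    refine sphereDegree_eq_zero_of_extends (convex_body hCconv) (body_mem_nhds hCopen ho)
      (continuous_radial hCconv hCopen ho) (radial_mem_body hCconv hCopen ho)
      (V := fun w => U (translate F w o)) (V₁ := fun w => U₁ (translate F w o))
      (hU.comp (continuous_translate o)) (hdir.continuous.comp (continuous_translate o))
      (fun w hw => hU0 _ hw.1) (fun s t ht h0 => ?_) hg
    set x := translate F (radial F C z R o s) o
    -- At this wall both fields have the sign of `D` under the equation of `H`, hence so does every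
    -- point of the segment between them.
    obtain ⟨H, hxH⟩ := hwall x (radial_mem_body hCconv hCopen ho s).1
      (translate_radial_notMem hCconv hCopen ho hball s)
    obtain ⟨y, hy⟩ := hD
    have hx0 := ((heq H).mem_iff _).1 hxH
    have h1 := ((heq H).sSameSide_iff (hne H H.2) _ _).1 (hdir.side H H.2 x hxH y hy)
    have h2 := ((heq H).sSameSide_iff (hne H H.2) _ _).1 (hside H H.2 x hxH y hy)
    have h0' := congrArg (fun w : F.direction => a H (w : Space l)) h0
    simp only [Submodule.coe_add, Submodule.coe_smul, map_add, map_smul, smul_eq_mul,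
      Submodule.coe_zero, map_zero] at h0'
    rw [map_add] at h1 h2
    have h3 : (1 - t) * ((a H x + a H (U₁ x) + c H) * (a H y + c H))
        + t * ((a H x + a H (U x) + c H) * (a H y + c H)) = 0 := by
      linear_combination (a H y + c H) * h0' + (a H y + c H) * hx0
    rcases ht.1.eq_or_lt with rfl | ht0
    · simp only [sub_zero, one_mul, zero_mul, add_zero] at h3
      exact h1.ne' h3
    · have := mul_pos ht0 h2
      have := mul_nonneg (sub_nonneg.2 ht.2) h1.le
      linarith
  refine hzero _ (Classical.epsilon_spec (p := IsChamberDegree A F C D) ?_)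
  -- The ball is chosen to contain the closed section too, so the inward condition on its boundary
  -- is vacuous.
  obtain ⟨R, hR⟩ := ((finite_vertices hA F).isBounded.union hbd').subset_ball p
  have hball : ∀ x : F, (x : Space l) ∈ closure C → dist (x : Space l) p < R := by
    intro x hx
    rw [hcl] at hx
    exact Metric.mem_ball.1 (hR (Or.inr ⟨(hF x).1 x.2, hx⟩))
  let o : F := ⟨p, hpF⟩
  have ho : (o : Space l) ∈ C ∩ Metric.ball (o : Space l) R :=
    ⟨hpC, Metric.mem_ball.2 (hball o (subset_closure hpC))⟩
  have hne0 : ∀ s : Metric.sphere (0 : F.direction) 1,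
      U (translate F (radial F C o R o s) o) ≠ 0 :=
    fun s => hU0 _ (radial_mem_body hCconv hCopen ho s).1
  let V : C(Metric.sphere (0 : F.direction) 1, F.direction) :=
    ⟨fun s => U (translate F (radial F C o R o s) o),
      hU.comp ((continuous_translate o).comp (continuous_radial hCconv hCopen ho))⟩
  refine ⟨_, o, R, U, o, unitMap V hne0, fun x hx => hR (Or.inl hx), ⟨hU, ?_, ?_, hside⟩, ho,
    fun s => rfl, rfl⟩
  · intro x hx _
    exact hU0 x (isClosed_closure.frontier_subset hx)
  · intro x hx hxR
    exact absurd hxR (hball x hx).ne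

/-! ### Points at infinity of a chamber -/

section Projective

variable {W : Type*} [AddCommGroup W] [Module ℝ W]

/-- The points of projective space at which two linear forms have values of the same sign. -/
def sameSignSet (φ ψ : W →ₗ[ℝ] ℝ) : Set (ℙ ℝ W) := {q | 0 < φ q.rep * ψ q.rep}

/-- One form has no sign at a projective point, but a product of two forms scales by a square. -/
theorem mk_mem_sameSignSet {φ ψ : W →ₗ[ℝ] ℝ} {w : W} (hw : w ≠ 0) :
    Projectivization.mk ℝ w hw ∈ sameSignSet φ ψ ↔ 0 < φ w * ψ w := by
  obtain ⟨k, hk⟩ := Projectivization.exists_smul_eq_mk_rep ℝ w hw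
  have hk0 : (k : ℝ) ≠ 0 := k.ne_zero
  have e : (Projectivization.mk ℝ w hw).rep = (k : ℝ) • w := hk.symm
  have : φ ((k : ℝ) • w) * ψ ((k : ℝ) • w) = (k : ℝ) ^ 2 * (φ w * ψ w) := by
    rw [map_smul, map_smul, smul_eq_mul, smul_eq_mul]; ring
  rw [sameSignSet, mem_ofPred_eq, e, this]
  exact mul_pos_iff_of_pos_left (by positivity)

theorem isOpen_sameSignSet [TopologicalSpace W] {φ ψ : W →ₗ[ℝ] ℝ} (hφ : Continuous φ)
    (hψ : Continuous ψ) : IsOpen (sameSignSet φ ψ) := by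
  rw [isOpen_coinduced]
  have : (fun w : {w : W // w ≠ 0} => Projectivization.mk ℝ w.1 w.2) ⁻¹' sameSignSet φ ψ
      = {w | 0 < φ w.1 * ψ w.1} := by
    ext w
    exact mk_mem_sameSignSet w.2
  rw [this]
  exact isOpen_lt continuous_const
    ((hφ.comp continuous_subtype_val).mul (hψ.comp continuous_subtype_val))

theorem tendsto_mk [TopologicalSpace W] {γ : ℝ → W} (hγ : Continuous γ) (hγ0 : ∀ s, γ s ≠ 0)
    {S : Filter ℝ} (hS : S ≤ 𝓝 0) :
    Tendsto (fun s => Projectivization.mk ℝ (γ s) (hγ0 s)) S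
      (𝓝 (Projectivization.mk ℝ (γ 0) (hγ0 0))) := by
  have h1 : Continuous fun w : {w : W // w ≠ 0} => Projectivization.mk ℝ w.1 w.2 :=
    continuous_coinduced_rng
  have h2 : Continuous fun s => Projectivization.mk ℝ (γ s) (hγ0 s) :=
    h1.comp (hγ.subtype_mk hγ0)
  exact (h2.tendsto 0).mono_left hS

end Projective

section AtInfinity

variable {l : ℕ} {ι : Type*} {a : ι → Space l →L[ℝ] ℝ} {c : ι → ℝ} {C : Set (Space l)}
  {p : Space l}

theorem prod_zero_ne_zero {v : Space l} (hv : v ≠ 0) : ((v, 0) : Space l × ℝ) ≠ 0 :=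
  fun h => hv (congrArg Prod.fst h)

theorem eq_mk_of_mem_atInfinity {q : ℙ ℝ (Space l × ℝ)} (hq : q ∈ atInfinity C) :
    ∃ (v : Space l) (hv : v ≠ 0), q = Projectivization.mk ℝ (v, 0) (prod_zero_ne_zero hv) := by
  induction q using Projectivization.ind with | h w hw
  obtain ⟨v, s⟩ := w
  have h := hq.2
  rw [Projectivization.submodule_mk, Submodule.span_singleton_le_iff_mem] at h
  obtain rfl : s = 0 := h
  exact ⟨v, fun h => hw (by rw [h]; rfl), rfl⟩

/-- The homogenization of the equation `a i x + c i`, multiplied by its value at `p`. -/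
def homogenization (a : ι → Space l →L[ℝ] ℝ) (c : ι → ℝ) (p : Space l) (i : ι) :
    Space l × ℝ →ₗ[ℝ] ℝ :=
  (a i p + c i) • ((a i).toLinearMap.comp (LinearMap.fst ℝ (Space l) ℝ)
    + c i • LinearMap.snd ℝ (Space l) ℝ)

theorem homogenization_apply (i : ι) (v : Space l) (s : ℝ) :
    homogenization a c p i (v, s) = (a i p + c i) * (a i v + c i * s) := by
  simp [homogenization]
  ring

theorem continuous_homogenization (i : ι) : Continuous (homogenization a c p i) := by
  have : (homogenization a c p i : Space l × ℝ → ℝ)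
      = fun z => (a i p + c i) * (a i z.1 + c i * z.2) :=
    funext fun z => homogenization_apply i z.1 z.2
  rw [this]
  fun_prop

/-- The two alternatives come from `[v : 0] = [-v : 0]`. If both fail, two homogenized equations
have opposite signs at `[v : 0]`; this is an open condition, and it fails throughout `C`. -/
theorem mk_mem_atInfinity_iff (hp : ∀ i, a i p + c i ≠ 0)
    (hC : C = {x | ∀ i, 0 < (a i p + c i) * (a i x + c i)}) {v : Space l}
    (hv : ((v, 0) : Space l × ℝ) ≠ 0) :
    Projectivization.mk ℝ ((v, 0) : Space l × ℝ) hv ∈ atInfinity C ↔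
      v ∈ recCone a c p ∨ -v ∈ recCone a c p := by
  constructor
  · rintro ⟨hcl, -⟩
    by_contra! h
    obtain ⟨h1, h2⟩ := h
    simp only [recCone, mem_ofPred_eq, not_forall, not_le, map_neg] at h1 h2
    obtain ⟨i, hi⟩ := h1
    obtain ⟨j, hj⟩ := h2
    have hopen : IsOpen (sameSignSet (homogenization a c p i) (-homogenization a c p j)) :=
      isOpen_sameSignSet (continuous_homogenization i) (continuous_homogenization j).neg
    have hmem : Projectivization.mk ℝ ((v, 0) : Space l × ℝ) hv ∈
        sameSignSet (homogenization a c p i) (-homogenization a c p j) := by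
      rw [mk_mem_sameSignSet, LinearMap.neg_apply, homogenization_apply, homogenization_apply]
      refine mul_pos_of_neg_of_neg (by simpa using hi) ?_
      simp only [mul_zero, add_zero]
      linarith
    obtain ⟨_, hz, x, hx, rfl⟩ := mem_closure_iff.1 hcl _ hopen hmem
    rw [hC] at hx
    have h3 := (mk_mem_sameSignSet _).1 hz
    rw [LinearMap.neg_apply, homogenization_apply, homogenization_apply, mul_one, mul_one] at h3
    have := mul_pos (hx i) (hx j)
    linarith
  · have key : ∀ (u : Space l) (hu : ((u, 0) : Space l × ℝ) ≠ 0), u ∈ recCone a c p →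
        Projectivization.mk ℝ ((u, 0) : Space l × ℝ) hu ∈ atInfinity C := by
      intro u hu hur
      have hu' : u ≠ 0 := fun h => hu (by rw [h]; rfl)
      refine ⟨?_, by
        rw [Projectivization.submodule_mk, Submodule.span_singleton_le_iff_mem]; rfl⟩
      -- For `s > 0` this represents the point `p + s⁻¹ u` of `C`; at `s = 0` it is `[u : 0]`.
      let γ : ℝ → Space l × ℝ := fun s => (s • p + u, s)
      have hγ : Continuous γ := by fun_prop
      have hγ0 : ∀ s, γ s ≠ 0 := by
        intro s h
        have h2 : s = 0 := congrArg Prod.snd h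
        have h1 : s • p + u = 0 := congrArg Prod.fst h
        rw [h2, zero_smul, zero_add] at h1
        exact hu' h1
      have ht := tendsto_mk hγ hγ0 (S := 𝓝[>] 0) nhdsWithin_le_nhds
      have e : Projectivization.mk ℝ (γ 0) (hγ0 0) = Projectivization.mk ℝ (u, 0) hu := by
        simp only [γ, zero_smul, zero_add]
      rw [e] at ht
      refine mem_closure_of_tendsto ht ?_
      filter_upwards [self_mem_nhdsWithin] with s hs
      have hs : 0 < s := hs
      refine ⟨p + s⁻¹ • u, ?_, ?_⟩
      · rw [hC]
        exact chamber_add_recCone (fun i => mul_self_pos.2 (hp i))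
          (recCone_smul_mem (inv_nonneg.2 hs.le) hur)
      · rw [toProj, Projectivization.mk_eq_mk_iff']
        refine ⟨s⁻¹, ?_⟩
        simp only [γ, Prod.smul_mk, smul_add, smul_smul, inv_mul_cancel₀ hs.ne', one_smul,
          smul_eq_mul]
    rintro (h | h)
    · exact key v hv h
    · have hv' : ((-v, 0) : Space l × ℝ) ≠ 0 := by
        refine prod_zero_ne_zero (neg_ne_zero.2 fun h => hv (by rw [h]; rfl))
      have e : Projectivization.mk ℝ ((v, 0) : Space l × ℝ) hv
          = Projectivization.mk ℝ ((-v, 0) : Space l × ℝ) hv' := by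
        rw [Projectivization.mk_eq_mk_iff']
        exact ⟨-1, by simp⟩
      rw [e]
      exact key _ hv' h

theorem submodule_spanAtInfinity (hp : ∀ i, a i p + c i ≠ 0)
    (hC : C = {x | ∀ i, 0 < (a i p + c i) * (a i x + c i)}) :
    Projectivization.Subspace.submodule (spanAtInfinity C)
      = (Submodule.span ℝ (recCone a c p)).map (LinearMap.inl ℝ (Space l) ℝ) := by
  apply le_antisymm
  · rw [← OrderIso.le_symm_apply, spanAtInfinity,
      Projectivization.Subspace.span_le_subspace_iff]
    intro q hq
    obtain ⟨v, hv, rfl⟩ := eq_mk_of_mem_atInfinity hq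
    refine (Submodule.mk_mem_projectivization_iff _ _).2 (Submodule.mem_map_of_mem ?_)
    rcases (mk_mem_atInfinity_iff hp hC _).1 hq with h | h
    · exact Submodule.subset_span h
    · exact neg_mem_iff.1 (Submodule.subset_span (s := recCone a c p) h)
  · rw [Submodule.map_le_iff_le_comap, Submodule.span_le]
    intro v hv
    rcases eq_or_ne v 0 with rfl | hv0
    · exact zero_mem _
    · refine (Projectivization.Subspace.mem_submodule_iff _ (prod_zero_ne_zero hv0)).2 ?_
      exact Projectivization.Subspace.subset_span _
        ((mk_mem_atInfinity_iff hp hC _).2 (Or.inl hv))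

theorem dimAtInfinity_eq (hp : ∀ i, a i p + c i ≠ 0)
    (hC : C = {x | ∀ i, 0 < (a i p + c i) * (a i x + c i)}) :
    dimAtInfinity C = (Module.finrank ℝ (Submodule.span ℝ (recCone a c p)) : ℤ) - 1 := by
  rw [dimAtInfinity, submodule_spanAtInfinity hp hC]
  congr 2
  exact (LinearEquiv.finrank_eq
    (Submodule.equivMapOfInjective _ LinearMap.inl_injective _)).symm

/-- `v` lies in the relative interior of the recession cone of the chamber of `p`. -/
def IsRelInt (a : ι → Space l →L[ℝ] ℝ) (c : ι → ℝ) (p v : Space l) : Prop :=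
  v ∈ recCone a c p ∧ ∀ i, a i v = 0 → ∀ r ∈ recCone a c p, a i r = 0

theorem IsRelInt.pos {v : Space l} (hp : ∀ i, a i p + c i ≠ 0) (hv : IsRelInt a c p v) {i : ι}
    (hi : a i v ≠ 0) : 0 < (a i p + c i) * a i v :=
  lt_of_le_of_ne (hv.1 i) (mul_ne_zero (hp i) hi).symm

/-- If equation `i` killed `v` but not `r`, then `v - s r` would leave the cone while staying in
`X(C)`. For small `s > 0` its negative would have to be in the cone, and the limit `-v` contradicts
pointedness. -/
theorem isRelInt_of_mem_relIntAtInfinity (ha : NoLine a) (hp : ∀ i, a i p + c i ≠ 0)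
    (hC : C = {x | ∀ i, 0 < (a i p + c i) * (a i x + c i)}) {v : Space l}
    (hv : ((v, 0) : Space l × ℝ) ≠ 0)
    (hmem : Projectivization.mk ℝ ((v, 0) : Space l × ℝ) hv ∈ relIntAtInfinity C)
    (hvr : v ∈ recCone a c p) : IsRelInt a c p v := by
  refine ⟨hvr, fun i hi r hr => ?_⟩
  by_contra hir
  have hv0 : v ≠ 0 := fun h => hv (by rw [h]; rfl)
  let γ : ℝ → Space l × ℝ := fun s => (v - s • r, 0)
  have hγ : Continuous γ := by fun_prop
  have hγ0 : ∀ s, γ s ≠ 0 := by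
    intro s h
    have h1 : v - s • r = 0 := congrArg Prod.fst h
    have h2 := congrArg (a i) h1
    rw [map_sub, map_smul, hi, map_zero, zero_sub, neg_eq_zero, smul_eq_mul] at h2
    have h3 : s = 0 := (mul_eq_zero.1 h2).resolve_right hir
    rw [h3, zero_smul, sub_zero] at h1
    exact hv0 h1
  have ht := tendsto_mk hγ hγ0 (S := 𝓝[>] 0) nhdsWithin_le_nhds
  have e : Projectivization.mk ℝ (γ 0) (hγ0 0) = Projectivization.mk ℝ (v, 0) hv := by
    simp only [γ, zero_smul, sub_zero]
  rw [e] at ht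
  have hspan : ∀ s, Projectivization.mk ℝ (γ s) (hγ0 s) ∈
      (spanAtInfinity C : Set (ℙ ℝ (Space l × ℝ))) := by
    intro s
    refine (Projectivization.Subspace.mem_submodule_iff _ (hγ0 s)).1 ?_
    rw [submodule_spanAtInfinity hp hC]
    exact Submodule.mem_map_of_mem (sub_mem (Submodule.subset_span hvr)
      (Submodule.smul_mem _ _ (Submodule.subset_span hr)))
  have hev := (tendsto_nhdsWithin_iff.2 ⟨ht, Eventually.of_forall hspan⟩).eventually hmem.2
  have hpos : 0 < (a i p + c i) * a i r :=
    lt_of_le_of_ne (hr i) (mul_ne_zero (hp i) hir).symm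
  have hneg : ∀ᶠ s : ℝ in 𝓝[>] 0, s • r - v ∈ recCone a c p := by
    filter_upwards [hev, self_mem_nhdsWithin] with s hs hs0
    have hs0 : 0 < s := hs0
    rcases (mk_mem_atInfinity_iff hp hC _).1 hs with h | h
    · have h1 := h i
      rw [map_sub, map_smul, hi, smul_eq_mul] at h1
      have := mul_pos hs0 hpos
      nlinarith
    · rwa [neg_sub] at h
  have hlim : Tendsto (fun s : ℝ => s • r - v) (𝓝[>] 0) (𝓝 (-v)) := by
    have hc : Continuous fun s : ℝ => s • r - v := by fun_prop
    have := (hc.tendsto 0).mono_left (nhdsWithin_le_nhds (s := Ioi 0))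
    simpa using this
  exact hv0 (eq_zero_of_mem_recCone_of_neg_mem ha hp hvr
    ((isClosed_recCone p).mem_of_tendsto hlim hneg))

/-- Equations killing `v` vanish on all of `X(C)`. The others keep agreeing signs, up to one global
sign, on the neighbourhood `N`, so points of `X(C)` in `N` come from the cone or its negative. -/
theorem IsRelInt.mk_mem_relIntAtInfinity [Finite ι] (hp : ∀ i, a i p + c i ≠ 0)
    (hC : C = {x | ∀ i, 0 < (a i p + c i) * (a i x + c i)}) {v : Space l}
    (hv : ((v, 0) : Space l × ℝ) ≠ 0) (hvr : IsRelInt a c p v) :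
    Projectivization.mk ℝ ((v, 0) : Space l × ℝ) hv ∈ relIntAtInfinity C := by
  refine ⟨(mk_mem_atInfinity_iff hp hC hv).2 (Or.inl hvr.1), ?_⟩
  let N : Set (ℙ ℝ (Space l × ℝ)) := ⋂ i, ⋂ j, {q | a i v ≠ 0 → a j v ≠ 0 →
    q ∈ sameSignSet (homogenization a c p i) (homogenization a c p j)}
  have hN : N ∈ 𝓝 (Projectivization.mk ℝ ((v, 0) : Space l × ℝ) hv) := by
    refine iInter_mem.2 fun i => iInter_mem.2 fun j => ?_
    by_cases hi : a i v = 0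
    · exact univ_mem' fun q h => absurd hi h
    by_cases hj : a j v = 0
    · exact univ_mem' fun q _ h => absurd hj h
    refine mem_of_superset ((isOpen_sameSignSet (continuous_homogenization i)
      (continuous_homogenization j)).mem_nhds ?_) fun q hq _ _ => hq
    rw [mk_mem_sameSignSet, homogenization_apply, homogenization_apply, mul_zero, mul_zero,
      add_zero, add_zero]
    exact mul_pos (hvr.pos hp hi) (hvr.pos hp hj)
  rw [mem_nhdsWithin_iff_exists_mem_nhds_inter]
  refine ⟨N, hN, ?_⟩
  rintro q ⟨hqN, hq⟩
  induction q using Projectivization.ind with | h w hw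
  have hq' := (Projectivization.Subspace.mem_submodule_iff _ hw).2 hq
  rw [submodule_spanAtInfinity hp hC] at hq'
  obtain ⟨u, hu, rfl⟩ := hq'
  refine (mk_mem_atInfinity_iff hp hC (v := u) hw).2 ?_
  have hsign : ∀ i j, a i v ≠ 0 → a j v ≠ 0 →
      0 < ((a i p + c i) * a i u) * ((a j p + c j) * a j u) := by
    intro i j hi hj
    have h := (mk_mem_sameSignSet hw).1 (mem_iInter.1 (mem_iInter.1 hqN i) j hi hj)
    rw [LinearMap.inl_apply, homogenization_apply, homogenization_apply, mul_zero, mul_zero,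
      add_zero, add_zero] at h
    exact h
  have hzero : ∀ i, a i v = 0 → a i u = 0 := by
    intro i hi
    have hle : Submodule.span ℝ (recCone a c p) ≤ LinearMap.ker (a i).toLinearMap :=
      Submodule.span_le.2 fun r hr => hvr.2 i hi r hr
    exact hle hu
  by_cases hex : ∃ i, a i v ≠ 0 ∧ (a i p + c i) * a i u < 0
  · obtain ⟨i, hi, hiu⟩ := hex
    right
    intro j
    by_cases hj : a j v = 0
    · rw [map_neg, hzero j hj, neg_zero, mul_zero]
    · have := hsign i j hi hj
      rw [map_neg, mul_neg]
      linarith [neg_of_mul_pos_right this hiu.le]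
  · push Not at hex
    left
    intro j
    by_cases hj : a j v = 0
    · rw [hzero j hj, mul_zero]
    · exact hex j hj

/-- Add to `w` one cone vector for each equation, not killed by it whenever possible. Each signed
equation is nonnegative on every summand, so nothing cancels. -/
theorem exists_isRelInt [Finite ι] {f : Space l →L[ℝ] ℝ} {w : Space l}
    (hp : ∀ i, a i p + c i ≠ 0) (hw : w ∈ recCone a c p)
    (hw1 : f w = 1) (hf : ∀ r ∈ recCone a c p, 0 ≤ f r) :
    ∃ v, IsRelInt a c p v ∧ f v = 1 := by
  classical
  have := Fintype.ofFinite ι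
  have hr : ∀ i, ∃ r ∈ recCone a c p, (∃ r' ∈ recCone a c p, a i r' ≠ 0) → a i r ≠ 0 := by
    intro i
    by_cases h : ∃ r' ∈ recCone a c p, a i r' ≠ 0
    · obtain ⟨r, hr, hr'⟩ := h
      exact ⟨r, hr, fun _ => hr'⟩
    · exact ⟨w, hw, fun h' => absurd h' h⟩
  choose r hr hr' using hr
  have hsum : ∀ g : Space l →L[ℝ] ℝ, g (w + ∑ i, r i) = g w + ∑ i, g (r i) := by
    intro g; rw [map_add, map_sum]
  have hf1 : 0 < f (w + ∑ i, r i) := by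
    rw [hsum, hw1]
    have := Finset.sum_nonneg fun i (_ : i ∈ Finset.univ) => hf (r i) (hr i)
    linarith
  have hmem : w + ∑ i, r i ∈ recCone a c p := by
    intro i
    rw [hsum, mul_add, Finset.mul_sum]
    exact add_nonneg (hw i) (Finset.sum_nonneg fun j _ => hr j i)
  refine ⟨(f (w + ∑ i, r i))⁻¹ • (w + ∑ i, r i),
    ⟨recCone_smul_mem (inv_nonneg.2 hf1.le) hmem, fun i hi r' hr'' => ?_⟩, ?_⟩
  · by_contra hne
    have h0 : a i (w + ∑ i, r i) = 0 := by
      rw [map_smul, smul_eq_mul] at hi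
      exact (mul_eq_zero.1 hi).resolve_left (inv_ne_zero hf1.ne')
    have h1 : (a i p + c i) * a i w + ∑ j, (a i p + c i) * a i (r j) = 0 := by
      rw [← Finset.mul_sum, ← mul_add, ← hsum, h0, mul_zero]
    have h2 := Finset.sum_nonneg fun j (_ : j ∈ Finset.univ) => hr j i
    have h3 := Finset.single_le_sum (f := fun j => (a i p + c i) * a i (r j))
      (fun j _ => hr j i) (Finset.mem_univ i)
    have h4 : (a i p + c i) * a i (r i) = 0 :=
      le_antisymm (by have := hw i; linarith) (hr i i)
    exact hr' i ⟨r', hr'', hne⟩ ((mul_eq_zero.1 h4).resolve_left (hp i))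
  · rw [map_smul, smul_eq_mul, inv_mul_cancel₀ hf1.ne']

end AtInfinity

/-! ### The opposite chamber -/

section Opposite

/-- The second factor is the value of equation `i` at `q - t v`, so far out along `-v` the equations
not killing `v` have the sign opposite to that at `p`. -/
theorem eventually_sub_smul_neg {E ι : Type*} [NormedAddCommGroup E] [NormedSpace ℝ E] [Finite ι]
    {a : ι → E →L[ℝ] ℝ} {c : ι → ℝ} {p v : E} (q : E)
    (hv : ∀ i, a i v ≠ 0 → 0 < (a i p + c i) * a i v) :
    ∀ᶠ t : ℝ in atTop, ∀ i, a i v ≠ 0 → (a i p + c i) * (a i q + c i - t * a i v) < 0 := by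
  rw [eventually_all]
  intro i
  by_cases hi : a i v = 0
  · exact Eventually.of_forall fun _ h => absurd hi h
  · have h := hv i hi
    filter_upwards [eventually_gt_atTop
      ((a i p + c i) * (a i q + c i) / ((a i p + c i) * a i v))] with t ht _
    rw [div_lt_iff₀ h] at ht
    linarith

variable {l : ℕ} {A : Set (AffineSubspace ℝ (Space l))} {a : A → Space l →L[ℝ] ℝ} {c : A → ℝ}
  {C : Set (Space l)} {p v : Space l}

/-- Crossing infinity flips exactly the equations not killing `v`. The direction `u` in the
definition of `opposite` may differ from `v`, but both are relatively interior and so are killed by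
the same equations. -/
theorem sign_of_mem_opposite [Finite A] (heq : ∀ H : A, IsEquation H.1 (a H) (c H))
    (ha : NoLine a) (hp : ∀ i, a i p + c i ≠ 0)
    (hC : C = {x | ∀ i, 0 < (a i p + c i) * (a i x + c i)}) (hv : IsRelInt a c p v)
    {y : Space l} (hy : y ∈ opposite A C) (i : A) :
    (a i v ≠ 0 → (a i p + c i) * (a i y + c i) < 0) ∧
      (a i v = 0 → 0 < (a i p + c i) * (a i y + c i)) := by
  obtain ⟨hyc, q, hq, u, hu, hu', hray, hev⟩ := hy
  have hur : u ∈ recCone a c p := by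
    intro i
    by_contra! h
    have hlt : 0 < -((a i p + c i) * a i u) := by linarith
    rw [hC] at hq
    -- The time at which a decreasing equation would vanish on the ray.
    have h1 := hray (((a i p + c i) * (a i q + c i)) / -((a i p + c i) * a i u))
      (div_nonneg (hq i).le hlt.le)
    rw [hC] at h1
    have h2 := h1 i
    rw [map_add, map_smul, smul_eq_mul] at h2
    have h3 := div_mul_cancel₀ ((a i p + c i) * (a i q + c i)) hlt.ne'
    nlinarith
  have hrel := isRelInt_of_mem_relIntAtInfinity ha hp hC hu hu' hur
  have hq' : 0 < (a i p + c i) * (a i q + c i) := by rw [hC] at hq; exact hq i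
  rw [connectedComponentIn_complement heq hyc] at hev
  obtain ⟨t, ht1, ht2⟩ := (hev.and
    (eventually_sub_smul_neg (a := a) (c := c) (p := p) q fun i hi => hrel.pos hp hi)).exists
  have h1 := ht1 i
  rw [map_sub, map_smul, smul_eq_mul] at h1
  constructor
  · intro hi
    have hiu : a i u ≠ 0 := fun h => hi (hrel.2 i h v hv.1)
    have h2 := ht2 i hiu
    rw [← sub_add_eq_add_sub] at h2
    by_contra! h
    have := mul_nonpos_of_nonneg_of_nonpos h h2.le
    have h3 : (a i p + c i) ^ 2 * ((a i y + c i) * (a i q - t * a i u + c i)) ≤ 0 := by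
      calc _ = _ := by ring
        _ ≤ _ := this
    have : 0 < (a i p + c i) ^ 2 := by have := hp i; positivity
    have := mul_pos this h1
    linarith
  · intro hi
    rw [hv.2 i hi u hur, mul_zero, sub_zero] at h1
    have h2 := mul_pos hq' h1
    have h3 : 0 < (a i q + c i) ^ 2 * ((a i p + c i) * (a i y + c i)) := by
      calc _ < _ := h2
        _ = _ := by ring
    exact pos_of_mul_pos_right h3 (sq_nonneg _)

theorem opposite_nonempty [Finite A] (heq : ∀ H : A, IsEquation H.1 (a H) (c H))
    (hp : ∀ i, a i p + c i ≠ 0)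
    (hC : C = {x | ∀ i, 0 < (a i p + c i) * (a i x + c i)}) (hv : IsRelInt a c p v)
    (hv0 : v ≠ 0) : (opposite A C).Nonempty := by
  obtain ⟨t₀, ht₀⟩ := eventually_atTop.1
    (eventually_sub_smul_neg (a := a) (c := c) (p := p) p fun i hi => hv.pos hp hi)
  have hval : ∀ t i, a i (p - t • v) + c i = a i p + c i - t * a i v := by
    intro t i
    rw [map_sub, map_smul, smul_eq_mul]; ring
  have hcomp : p - t₀ • v ∈ complement A := by
    rw [mem_complement_iff heq]
    intro i
    rw [hval]
    by_cases hi : a i v = 0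
    · rw [hi, mul_zero, sub_zero]; exact hp i
    · exact right_ne_zero_of_mul (ht₀ t₀ le_rfl i hi).ne
  refine ⟨p - t₀ • v, hcomp, p, ?_, v, prod_zero_ne_zero hv0,
    hv.mk_mem_relIntAtInfinity hp hC _, fun t ht => ?_, ?_⟩
  · rw [hC]
    exact fun i => mul_self_pos.2 (hp i)
  · rw [hC]
    exact chamber_add_recCone (fun i => mul_self_pos.2 (hp i)) (recCone_smul_mem ht hv.1)
  · rw [connectedComponentIn_complement heq hcomp]
    filter_upwards [eventually_ge_atTop t₀] with t ht i
    rw [hval, hval]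
    by_cases hi : a i v = 0
    · simp only [hi, mul_zero, sub_zero]
      exact mul_self_pos.2 (hp i)
    · have h1 := mul_pos_of_neg_of_neg (ht₀ t₀ le_rfl i hi) (ht₀ t ht i hi)
      have h3 : 0 < (a i p + c i) ^ 2 * ((a i p + c i - t₀ * a i v) *
          (a i p + c i - t * a i v)) := by
        calc _ < _ := h1
          _ = _ := by ring
      exact pos_of_mul_pos_right h3 (sq_nonneg _)

end Opposite

/-! ### The hyperplane near infinity -/

section Flag

variable {l : ℕ} {A : Set (AffineSubspace ℝ (Space l))} {a : A → Space l →L[ℝ] ℝ} {c : A → ℝ}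

/-- Translation along a common parallel line preserves every intersection of members of `A`,
including a one-point edge. -/
theorem noLine_of_isEssential (heq : ∀ H : A, IsEquation H.1 (a H) (c H)) (h : IsEssential A) :
    NoLine a := by
  obtain ⟨x, S, hS, hx⟩ := h
  intro u hu
  have hxm : x ∈ (⋂ H ∈ S, (H : Set (Space l))) ∩
      ((⊤ : AffineSubspace ℝ (Space l)) : Set (Space l)) := hx ▸ mem_singleton x
  have hmem : x + u ∈ (⋂ H ∈ S, (H : Set (Space l))) ∩
      ((⊤ : AffineSubspace ℝ (Space l)) : Set (Space l)) := by
    refine ⟨mem_iInter₂.2 fun H hH => ?_, AffineSubspace.mem_top _ _ _⟩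
    have h1 := ((heq ⟨H, hS hH⟩).mem_iff x).1 (mem_iInter₂.1 hxm.1 H hH)
    refine ((heq ⟨H, hS hH⟩).mem_iff _).2 ?_
    rw [map_add, hu, add_zero, h1]
  rw [hx] at hmem
  simpa using hmem

theorem projClosure_le_ker {H : AffineSubspace ℝ (Space l)} {b : Space l →L[ℝ] ℝ} {e : ℝ}
    (h : IsEquation H b e) {z : Space l × ℝ} (hz : z ∈ projClosure H) : b z.1 + e * z.2 = 0 := by
  let φ : Space l × ℝ →ₗ[ℝ] ℝ := b.toLinearMap.comp (LinearMap.fst ℝ (Space l) ℝ)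
    + e • LinearMap.snd ℝ (Space l) ℝ
  have hle : projClosure H ≤ LinearMap.ker φ := by
    refine Submodule.span_le.2 ?_
    rintro _ ⟨x, hx, rfl⟩
    have := (h.mem_iff x).1 hx
    simpa [φ] using this
  have := hle hz
  simpa [φ] using this

theorem mem_projClosure {H : AffineSubspace ℝ (Space l)} {x : Space l} (hx : x ∈ H) :
    (x, (1 : ℝ)) ∈ projClosure H :=
  Submodule.subset_span ⟨x, hx, rfl⟩

/-- A generic hyperplane contains no vertex of the arrangement. -/
theorem notMem_of_isVertexIn (hl : 1 ≤ l) (heq : ∀ H : A, IsEquation H.1 (a H) (c H))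
    {Fl : ℕ → AffineSubspace ℝ (Space l)} (hFl : IsGenericFlagNearInfinity A Fl) {y : Space l}
    (hy : IsVertexIn a c 0 y) : y ∉ Fl (l - 1) := by
  intro hyF
  let X : Submodule ℝ (Space l × ℝ) := sInf (projClosure '' {H ∈ A | y ∈ H})
  have hX : X ∈ projEdges A := by
    refine ⟨_, ?_, rfl⟩
    exact (image_mono fun H hH => hH.1).trans (subset_insert _ _)
  have hyX : (y, (1 : ℝ)) ∈ X := by
    rw [Submodule.mem_sInf]
    rintro _ ⟨H, hH, rfl⟩
    exact mem_projClosure hH.2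
  have hle : X ≤ ℝ ∙ (y, (1 : ℝ)) := by
    rintro ⟨u, s⟩ hu
    rw [Submodule.mem_span_singleton]
    refine ⟨s, ?_⟩
    have h0 : u - s • y = 0 := by
      refine hy _ rfl fun H hH => ?_
      have hz : (u, s) ∈ projClosure H.1 :=
        (Submodule.mem_sInf.1 hu) _ ⟨H.1, ⟨H.2, ((heq H).mem_iff y).2 hH⟩, rfl⟩
      have h1 := projClosure_le_ker (heq H) hz
      rw [map_sub, map_smul, smul_eq_mul]
      linear_combination h1 - s * hH
    rw [Prod.smul_mk, smul_eq_mul, mul_one, ← sub_eq_zero.1 h0]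
  have h1 : Module.finrank ℝ X ≤ 1 :=
    (Submodule.finrank_mono hle).trans
      (finrank_span_singleton (fun h => one_ne_zero (congrArg Prod.snd h))).le
  -- The edge `X` through `y` has linear dimension at most one, so the truncated expected dimension
  -- `finrank X + (l - 1) - l` is zero, although `(y, 1)` lies in the intersection.
  have h2 := hFl.generic (l - 1) (Nat.sub_le _ _) X hX
  have h3 : 0 < Module.finrank ℝ ↥(X ⊓ projClosure (Fl (l - 1))) := by
    rw [Module.finrank_pos_iff, Submodule.nontrivial_iff_ne_bot]
    intro hbot
    have : (y, (1 : ℝ)) ∈ (⊥ : Submodule ℝ (Space l × ℝ)) :=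
      hbot ▸ Submodule.mem_inf.2 ⟨hyX, mem_projClosure hyF⟩
    exact one_ne_zero (congrArg Prod.snd ((Submodule.mem_bot ℝ).1 this))
  omega

/-- The hyperplane of the flag has an equation that is negative at all vertices. -/
theorem exists_equation_neg_vertices (hl : 1 ≤ l)
    (heq : ∀ H : A, IsEquation H.1 (a H) (c H))
    {Fl : ℕ → AffineSubspace ℝ (Space l)} (hFl : IsGenericFlagNearInfinity A Fl) :
    ∃ (f : Space l →L[ℝ] ℝ) (d : ℝ), IsEquation (Fl (l - 1)) f d ∧
      ∀ y, IsVertexIn a c 0 y → f y + d < 0 := by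
  have hne := hFl.nonempty (l - 1) (Nat.sub_le _ _)
  have hhyp : IsHyperplane (Fl (l - 1)) :=
    ⟨hne, by rw [hFl.finrank_direction _ (Nat.sub_le _ _)]; omega⟩
  obtain ⟨f, d, hf⟩ := hhyp.exists_isEquation
  have hvtop : ∀ y, IsVertexIn a c 0 y → y ∈ vertices A (Fl (l - 1 + 1)) := by
    intro y hy
    have e : l - 1 + 1 = l := by omega
    rw [e, hFl.top]
    exact mem_vertices_of_isVertexIn (f := 0) (d := 0) heq (by simp) (AffineSubspace.mem_top _ _ _)
      hy
  have hne0 : ∀ y, IsVertexIn a c 0 y → f y + d ≠ 0 := fun y hy h =>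
    notMem_of_isVertexIn hl heq hFl hy ((hf.mem_iff y).2 h)
  have hsame : ∀ y z, IsVertexIn a c 0 y → IsVertexIn a c 0 z →
      0 ≤ (f y + d) * (f z + d) := by
    intro y z hy hz
    by_contra! h
    exact hFl.near (l - 1) (by omega) y (hvtop y hy) z (hvtop z hz) (hf.sOppSide_of_mul_neg hne h)
  by_cases hex : ∃ y, IsVertexIn a c 0 y ∧ 0 < f y + d
  · obtain ⟨y, hy, hypos⟩ := hex
    refine ⟨-f, -d, ⟨neg_ne_zero.2 hf.ne_zero, fun x => ?_⟩, fun z hz => ?_⟩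
    · rw [hf.mem_iff, neg_apply, ← neg_add, neg_eq_zero]
    · have h1 := nonneg_of_mul_nonneg_right (hsame y z hy hz) hypos
      have h2 := lt_of_le_of_ne h1 (hne0 z hz).symm
      rw [neg_apply]
      linarith
  · push Not at hex
    exact ⟨f, d, hf, fun y hy => lt_of_le_of_ne (hex y hy) (hne0 y hy)⟩

end Flag

/-! ### The vector field -/

/-- Let `C` and `C'` be distinct chambers with bounded nonempty sections by `F`. If the recession
cone of `C'` does not span more dimensions than that of `C`, then `deg(C', C^∨) = 0`: the field
`x ↦ p - x + t (w x - v)` is directed to the opposite chamber of `C` and has no zeros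
on `closure C' ∩ F`. -/
theorem chamberDegree_opposite_eq_zero {l : ℕ} {A : Set (AffineSubspace ℝ (Space l))}
    (hA : A.Finite) {a : A → Space l →L[ℝ] ℝ} {c : A → ℝ}
    (heq : ∀ H : A, IsEquation H.1 (a H) (c H)) (hne : ∀ H ∈ A, (H : Set (Space l)).Nonempty)
    (ha : NoLine a) {F : AffineSubspace ℝ (Space l)} {f : Space l →L[ℝ] ℝ} {d : ℝ}
    (hF : IsEquation F f d) (hv : ∀ y, IsVertexIn a c 0 y → f y + d < 0)
    {C C' : Set (Space l)} (hC : C ∈ chambers A) (hC' : C' ∈ chambers A)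
    (hCF : (C ∩ (F : Set (Space l))).Nonempty) (hCF' : (C' ∩ (F : Set (Space l))).Nonempty)
    (hbd : Bornology.IsBounded (C ∩ (F : Set (Space l))))
    (hbd' : Bornology.IsBounded (C' ∩ (F : Set (Space l))))
    (hCC' : C ≠ C') (hdim : dimAtInfinity C' ≤ dimAtInfinity C) :
    chamberDegree A F C' (opposite A C) = 0 := by
  have : Finite A := hA
  obtain ⟨p, hpC, hpF⟩ := hCF
  obtain ⟨p', hpC', hpF'⟩ := hCF'
  obtain ⟨hp, hCeq⟩ := chamber_eq heq hC hpC
  obtain ⟨hp', hCeq'⟩ := chamber_eq heq hC' hpC'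
  have hFne : (F : Set (Space l)).Nonempty := ⟨p, hpF⟩
  have hfp := (hF.mem_iff p).1 hpF
  obtain ⟨w, hw⟩ := exists_continuous_faceRecession (a := a) (c := c) (f := f)
    (F := (F : Set (Space l)))
    fun x hx => exists_faceRecession ha hv x ((hF.mem_iff x).1 hx).ge
  have hbdC : Bornology.IsBounded {x | f x + d = 0 ∧
      ∀ i, 0 < (a i p + c i) * (a i x + c i)} := by
    refine hbd.subset ?_
    rintro x ⟨hxF, hx⟩
    refine ⟨?_, (hF.mem_iff x).2 hxF⟩
    rw [hCeq]
    exact hx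
  have hbdC' : Bornology.IsBounded {x | f x + d = 0 ∧
      ∀ i, 0 < (a i p' + c i) * (a i x + c i)} := by
    refine hbd'.subset ?_
    rintro x ⟨hxF, hx⟩
    refine ⟨?_, (hF.mem_iff x).2 hxF⟩
    rw [hCeq']
    exact hx
  have hwp := hw ⟨p, hpF⟩
  have hwrec : w ⟨p, hpF⟩ ∈ recCone a c p :=
    hwp.2.mem_recCone fun i => mul_self_nonneg _
  obtain ⟨v, hvrel, hfv⟩ := exists_isRelInt hp hwrec hwp.1 fun r hr => by
    rcases eq_or_ne r 0 with rfl | hr0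
    · rw [map_zero]
    · exact (pos_of_mem_recCone ha hp hfp hbdC hwrec hwp.1 hr hr0).le
  have hv0 : v ≠ 0 := by
    rintro rfl
    rw [map_zero] at hfv
    exact zero_ne_one hfv
  have hclC' : closure C' = {x | ∀ i, 0 ≤ (a i p' + c i) * (a i x + c i)} := by
    conv_lhs => rw [hCeq']
    exact closure_signs hp'
  have hwC' : ∀ x : F, (x : Space l) ∈ closure C' → w x ∈ recCone a c p' := by
    intro x hx
    rw [hclC'] at hx
    exact (hw x).2.mem_recCone hx
  -- the field has no zeros on the closure of `C'`
  have hnz : ∀ᶠ t : ℝ in atTop, ∀ x : F, (x : Space l) ∈ closure C' →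
      p - (x : Space l) + t • (w x - v) ≠ 0 := by
    by_cases hvC' : v ∈ recCone a c p'
    · have hsub : recCone a c p ⊆ recCone a c p' := by
        intro r hr i
        by_cases hi : a i v = 0
        · rw [hvrel.2 i hi r hr, mul_zero]
        · have h1 := mul_nonneg (hvC' i) (hr i)
          have h2 : 0 ≤ ((a i p + c i) * a i v) * ((a i p' + c i) * a i r) := by
            calc _ ≤ _ := h1
              _ = _ := by ring
          exact nonneg_of_mul_nonneg_right h2 (hvrel.pos hp hi)
      have hspan : Submodule.span ℝ (recCone a c p) = Submodule.span ℝ (recCone a c p') := by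
        refine Submodule.eq_of_le_of_finrank_le (Submodule.span_mono hsub) ?_
        rw [dimAtInfinity_eq hp hCeq, dimAtInfinity_eq hp' hCeq'] at hdim
        omega
      -- Distinct chambers are separated by some hyperplane; as `v` is in both cones, that
      -- hyperplane is parallel to `v`.
      obtain ⟨i, hi⟩ : ∃ i, (a i p + c i) * (a i p' + c i) < 0 := by
        by_contra! h
        have hpp : ∀ i, 0 < (a i p + c i) * (a i p' + c i) := fun i =>
          lt_of_le_of_ne (h i) (mul_ne_zero (hp i) (hp' i)).symm
        have hp'C : p' ∈ C := by rw [hCeq]; exact hpp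
        exact hCC' ((chamber_eq heq hC hp'C).2.trans hCeq'.symm)
      have hiv : a i v = 0 := by
        by_contra hiv
        have h1 := mul_nonneg (hvC' i) (hvrel.1 i)
        have h2 : 0 ≤ (a i v) ^ 2 * ((a i p + c i) * (a i p' + c i)) := by
          calc _ ≤ _ := h1
            _ = _ := by ring
        have h3 := nonneg_of_mul_nonneg_right h2 (by positivity)
        linarith
      refine Eventually.of_forall fun t x hx h0 => ?_
      have hiw : a i (w x) = 0 := by
        have hle : Submodule.span ℝ (recCone a c p) ≤ LinearMap.ker (a i).toLinearMap :=
          Submodule.span_le.2 fun r hr => hvrel.2 i hiv r hr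
        rw [hspan] at hle
        exact hle (Submodule.subset_span (hwC' x hx))
      have h1 := congrArg (a i) h0
      rw [map_add, map_smul, map_sub, map_sub, hiw, hiv, sub_zero, smul_zero, add_zero,
        map_zero] at h1
      rw [hclC'] at hx
      have h2 := hx i
      have h3 : a i (x : Space l) + c i = a i p + c i := by linarith
      rw [h3] at h2
      linarith
    -- Here `w x` stays at distance at least `δ` from `v`, while `p - x` is bounded by `M + ‖p‖`.
    · obtain ⟨δ, hδ, hball⟩ := Metric.isOpen_iff.1 (isClosed_recCone (a := a) (c := c)
        p').isOpen_compl v hvC'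
      obtain ⟨M, hM⟩ := (isBounded_closed_section hp' ((hF.mem_iff p').1 hpF')
        hbdC').exists_norm_le
      filter_upwards [eventually_gt_atTop ((M + ‖p‖) / δ), eventually_gt_atTop 0]
        with t ht ht0 x hx h0
      have hge : δ ≤ ‖w x - v‖ := by
        by_contra! h
        exact hball (mem_ball_iff_norm.2 h) (hwC' x hx)
      rw [hclC'] at hx
      have h1 := hM x ⟨(hF.mem_iff x).1 x.2, hx⟩
      have h2 : t • (w x - v) = (x : Space l) - p := by
        rw [← neg_sub p, eq_neg_iff_add_eq_zero, add_comm]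
        exact h0
      have h3 : t * ‖w x - v‖ ≤ M + ‖p‖ := by
        have := congrArg norm h2
        rw [norm_smul, Real.norm_of_nonneg ht0.le] at this
        have := norm_sub_le (x : Space l) p
        linarith
      rw [div_lt_iff₀ hδ] at ht
      have := mul_le_mul_of_nonneg_left hge ht0.le
      linarith
  obtain ⟨t, ht, ht'⟩ := (hnz.and
    (eventually_sub_smul_neg (a := a) (c := c) (p := p) p fun i hi => hvrel.pos hp hi)).exists
  let U : F → F.direction := fun x => ⟨p - (x : Space l) + t • (w x - v), by
    have hfx := (hF.mem_iff x).1 x.2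
    rw [hF.mem_direction_iff hFne, map_add, map_smul, map_sub, map_sub, (hw x).1, hfv, sub_self,
      smul_zero]
    linarith⟩
  have hU : Continuous U := by
    refine Continuous.subtype_mk ?_ _
    exact (continuous_const.sub continuous_subtype_val).add
      ((w.continuous.sub continuous_const).const_smul t)
  refine chamberDegree_eq_zero hA heq hne hF.mem_iff hC' hpC' hpF' hbd'
    (opposite_nonempty heq hp hCeq hvrel hv0) hU (fun H hH x hx y hy => ?_)
    fun x hx h => ht x hx (congrArg Subtype.val h)
  have hx0 := ((heq ⟨H, hH⟩).mem_iff _).1 hx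
  rw [(heq ⟨H, hH⟩).sSameSide_iff (hne H hH)]
  -- On `H` the term `w x` drops out, leaving the value of the equation at `p - t v`.
  have hval : a ⟨H, hH⟩ ((x : Space l) + (U x : Space l)) + c ⟨H, hH⟩
      = a ⟨H, hH⟩ p + c ⟨H, hH⟩ - t * a ⟨H, hH⟩ v := by
    change a ⟨H, hH⟩ ((x : Space l) + (p - (x : Space l) + t • (w x - v))) + c ⟨H, hH⟩ = _
    rw [map_add, map_add, map_sub, map_smul, map_sub, ((hw x).2 ⟨H, hH⟩).2 hx0, smul_eq_mul]
    ring
  rw [hval]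
  obtain ⟨h1, h2⟩ := sign_of_mem_opposite heq ha hp hCeq hvrel hy ⟨H, hH⟩
  by_cases hi : a ⟨H, hH⟩ v = 0
  · rw [hi, mul_zero, sub_zero]
    exact h2 hi
  · have h3 := mul_pos_of_neg_of_neg (ht' ⟨H, hH⟩ hi) (h1 hi)
    have h4 : 0 < (a ⟨H, hH⟩ p + c ⟨H, hH⟩) ^ 2 * ((a ⟨H, hH⟩ p + c ⟨H, hH⟩
        - t * a ⟨H, hH⟩ v) * (a ⟨H, hH⟩ y + c ⟨H, hH⟩)) := by
      calc _ < _ := h3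
        _ = _ := by ring
    exact pos_of_mul_pos_right h4 (sq_nonneg _)

end RealArrangement

end

/-! ### Upper triangularity of the degree matrix -/

theorem theorem4p3 {l : ℕ} (hl : 1 ≤ l)
    (A : Set (AffineSubspace ℝ (RealArrangement.Space l))) (hA : A.Finite)
    (hH : ∀ H ∈ A, RealArrangement.IsHyperplane H)
    (hess : RealArrangement.IsEssential A)
    (Fl : ℕ → AffineSubspace ℝ (RealArrangement.Space l))
    (hFl : RealArrangement.IsGenericFlagNearInfinity A Fl)
    {b : ℕ} (C : Fin b ≃ RealArrangement.bchK A Fl (l - 1))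
    (hC : ∀ i j : Fin b, i ≤ j →
      RealArrangement.dimAtInfinity (C j : Set (RealArrangement.Space l)) ≤
        RealArrangement.dimAtInfinity (C i : Set (RealArrangement.Space l))) :
    (Matrix.of fun i j : Fin b =>
      RealArrangement.chamberDegree A (Fl (l - 1)) (C i : Set (RealArrangement.Space l))
        (RealArrangement.opposite A
          (C j : Set (RealArrangement.Space l)))).BlockTriangular id := by
  intro i j hij
  choose a c heq using fun H : A => (hH H.1 H.2).exists_isEquation
  obtain ⟨f, d, hF, hneg⟩ := RealArrangement.exists_equation_neg_vertices hl heq hFl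
  obtain ⟨⟨hj, hjF, -⟩, hjb⟩ := (C j).2
  obtain ⟨⟨hi, hiF, -⟩, hib⟩ := (C i).2
  -- Below the diagonal `j < i`: the column chamber `C j` is the one whose opposite is taken, and it
  -- has the larger or equal dimension at infinity.
  exact RealArrangement.chamberDegree_opposite_eq_zero hA heq (fun H hHA => (hH H hHA).1)
    (RealArrangement.noLine_of_isEssential heq hess) hF hneg hj hi hjF hiF hjb hib
    (fun h => hij.ne (C.injective (Subtype.ext h))) (hC j i hij.le)
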